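/- Let $p,t\in\mathbb{C}^*$ with $|p|<1$, $|t|<1$, and put $\theta(u)=\prod_{i\ge 0}(1-p^iu)(1-p^{i+1}/u)$ and $e(u,v)=u^{-1}\theta(uv)\theta(u/v)$ for $u,v\in\mathbb{C}^*$. Let $s\ge 1$ and $n\ge 0$ be integers, let $\mathcal{H}_{s-1,n}$ be the $\mathbb{C}$-vector space of all holomorphic functions $f$ on $(\mathbb{C}^*)^n$ which are invariant under permutations and inversions of the coordinates and satisfy $f(z_1,\ldots,pz_i,\ldots,z_n)=f(z)(pz_i^2)^{-s+1}$ for $i=1,\ldots,n$, and let $Z_{s,n}=\{\mu\in\mathbb{N}^s : \mu_1+\cdots+\mu_s=n\}$. Let $c=(c_1,\ldots,c_s)\in(\mathbb{C}^*)^s$ be generic in the sense that $e(t^ic_k,t^jc_l)\neq 0$ for all $k\ne l$ and all $i,j\ge 0$ with $i+j<n$. For $\nu\in Z_{s,n}$ put $$(c)_{t,\nu}=(c_1,tc_1,\ldots,t^{\nu_1-1}c_1,\ \ldots,\ c_s,tc_s,\ldots,t^{\nu_s-1}c_s)\in(\mathbb{C}^*)^n .$$ Then there is a unique $\mathbb{C}$-basis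 $\{E_\mu(c;z)\}_{\mu\in Z_{s,n}}$ of $\mathcal{H}_{s-1,n}$ with $E_\mu(c;(c)_{t,\nu})=\delta_{\mu,\nu}$ for all $\mu,\nu\in Z_{s,n}$. Moreover, for every $\mu\in Z_{s,n}$ such that $\theta(t^k)\ne 0$ for $1\le k\le\max_i\mu_i$, and every $u\in\mathbb{C}^*$, $$E_{\mu}(c;(u,tu,\ldots,t^{n-1}u))=\frac{[t^{-n}]_{n}\prod_{i=1}^{s}[u/c_i]_{n-\mu_i}[t^{\mu_i}uc_i]_{n-\mu_i}}{\prod_{i,j=1}^{s}[t^{-\mu_j}c_i/c_j]_{\mu_i}\prod_{1\le i<j\le s}[c_ic_j]_{\mu_i+\mu_j}},$$ where $[x]=x^{-1/2}\theta(x)$ and $[x]_k=[x][tx]\cdots[t^{k-1}x]$. Here arbitrary square roots of $t$, $u$, $c_1,\ldots,c_s$ are fixed, and the square root of each monomial in $t,u,c_1,\ldots,c_s$ is the corresponding monomial in these square roots; the formula holds for every such choice. -/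

import Mathlib

noncomputable section

namespace EllipticBC

/-- The multiplicative theta function `θ(u;p) = (u;p)_∞ (p/u;p)_∞`, where
`(u;p)_∞ = ∏_{i ≥ 0} (1 - p^i u)`. -/
def theta (p u : ℂˣ) : ℂ :=
  (∏' i : ℕ, (1 - (p : ℂ) ^ i * (u : ℂ))) * ∏' i : ℕ, (1 - (p : ℂ) ^ i * ((p : ℂ) / (u : ℂ)))

/-- `e(u,v;p) = u⁻¹ θ(uv;p) θ(u/v;p)`. -/
def e (p u v : ℂˣ) : ℂ :=
  (u : ℂ)⁻¹ * theta p (u * v) * theta p (u / v)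

/-- The odd theta function `[x] = x^{-1/2} θ(x;p)`, as a function of a square root `ξ` of `x`:
`odd p ξ = [ξ²] = ξ⁻¹ θ(ξ²;p)`. -/
def odd (p ξ : ℂˣ) : ℂ :=
  (ξ : ℂ)⁻¹ * theta p (ξ ^ 2)

/-- The `t`-shifted factorial `[x]_k = [x][tx]⋯[t^{k-1}x]`, as a function of square roots
`τ` of `t` and `ξ` of `x`. -/
def oddFactorial (p τ ξ : ℂˣ) (k : ℕ) : ℂ :=
  ∏ l ∈ Finset.range k, odd p (τ ^ l * ξ)

/-- The index set `Z_{s,n}` of all `μ ∈ ℕ^s` with `|μ| = n`. -/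
abbrev Z (s n : ℕ) : Type := {μ : Fin s → ℕ // ∑ i, μ i = n}

/-- Holomorphy of a function on the algebraic torus `(ℂ*)^n`, regarded as an open subset
of `ℂ^n`. -/
def Holomorphic {n : ℕ} (f : (Fin n → ℂˣ) → ℂ) : Prop :=
  ∃ F : (Fin n → ℂ) → ℂ, DifferentiableOn ℂ F {z | ∀ i, z i ≠ 0} ∧
    ∀ z : Fin n → ℂˣ, F (fun i => (z i : ℂ)) = f z

/-- The space `H_{s-1,n}^{(p)}` of holomorphic functions `f` on `(ℂ*)^n`, invariant under
permutations and inversions of the coordinates, with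
`f(z₁,…,p z_i,…,z_n) = f(z) (p z_i²)^{-s+1}` for all `i`. -/
def thetaSpace (p : ℂˣ) (s n : ℕ) : Submodule ℂ ((Fin n → ℂˣ) → ℂ) where
  carrier := {f | Holomorphic f ∧
    (∀ (σ : Equiv.Perm (Fin n)) z, f (z ∘ σ) = f z) ∧
    (∀ i z, f (Function.update z i (z i)⁻¹) = f z) ∧
    (∀ i z, f (Function.update z i (p * z i)) =
      f z * ((p : ℂ) * (z i : ℂ) ^ 2) ^ (-(s : ℤ) + 1))}
  zero_mem' := ⟨⟨0, by fun_prop, by simp⟩, by simp, by simp, by simp⟩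
  add_mem' := by
    rintro f g ⟨⟨F, hF, hFf⟩, h1, h2, h3⟩ ⟨⟨G, hG, hGg⟩, k1, k2, k3⟩
    refine ⟨⟨F + G, hF.add hG, fun z => by simp [hFf, hGg]⟩, fun σ z => ?_, fun i z => ?_,
      fun i z => ?_⟩
    · simp [h1, k1]
    · simp [h2, k2]
    · simp only [Pi.add_apply, h3, k3, add_mul]
  smul_mem' := by
    rintro a f ⟨⟨F, hF, hFf⟩, h1, h2, h3⟩
    refine ⟨⟨a • F, hF.const_smul a, fun z => by simp [hFf]⟩, fun σ z => ?_, fun i z => ?_,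
      fun i z => ?_⟩
    · simp [h1]
    · simp [h2]
    · simp only [Pi.smul_apply, smul_eq_mul, h3, mul_assoc]

/-- The reference point `(c)_{t,μ} = (c₁, tc₁, …, t^{μ₁-1}c₁, …, c_s, tc_s, …, t^{μ_s-1}c_s)`;
`finSigmaFinEquiv` is the lexicographic enumeration of the pairs `(i, a)` with `a < μ i`. -/
def refPoint (t : ℂˣ) {s n : ℕ} (c : Fin s → ℂˣ) (μ : Z s n) : Fin n → ℂˣ :=
  fun j =>
    let q := finSigmaFinEquiv.symm (Fin.cast μ.2.symm j)
    t ^ (q.2 : ℕ) * c q.1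

/-- The point `(u)_{t,n} = (u, tu, …, t^{n-1}u)`. -/
def geomPoint (t u : ℂˣ) (n : ℕ) : Fin n → ℂˣ :=
  fun j => t ^ (j : ℕ) * u

/-- `E = (E_μ)` is an interpolation basis of `H_{s-1,n}^{(p)}` with respect to `c`:
a `ℂ`-basis with `E_μ((c)_{t,ν}) = δ_{μ,ν}`. -/
def IsInterpolationBasis (p t : ℂˣ) {s n : ℕ} (c : Fin s → ℂˣ)
    (E : Module.Basis (Z s n) ℂ (thetaSpace p s n)) : Prop :=
  ∀ μ ν : Z s n, (E μ : (Fin n → ℂˣ) → ℂ) (refPoint t c ν) = if μ = ν then 1 else 0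

end EllipticBC

end

/-! The proof rests on dimension counts. If `f` is holomorphic on ℂ* with `f(pu) = κ u⁻ᵐ f(u)`, its
Laurent coefficients satisfy `pᵏ aₖ = κ aₖ₊ₘ`, so for `m ≥ 1` any `m` consecutive ones determine
`f`. For `m = 2(s-1)` and `f` inversion-invariant, `a₋ₖ = aₖ` leaves only `a₀, …, aₛ₋₁` (for `s =
1`, `κ = 1`, only constants remain). Once a dual family for evaluation at as many points is
exhibited, those values determine `f`. This gives Lagrange interpolation at `c₁, …, cₛ` in each
variable (`eq_sum_lagrange`).

Setting the first variable to `cₖ` turns the reference points with `νₖ > 0` into those in one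
variable fewer, with `cₖ` replaced by `tcₖ`. By induction, evaluation at all reference points is
injective (`eq_zero_of_refPoint`). Symmetrized products of Lagrange functions show that the
dimension is at least `|Z_{s,n}|`, so evaluation is an isomorphism and the basis is its inverse
image of the standard one.

The same restriction sends `E_μ` to `E_{μ-εₖ}` for the shifted parameters, or to 0 if `μₖ = 0`.
Interpolating in the first variable thus writes `E_μ(c; u, tu, …)` as a sum over `k` of Lagrange
functions at `u` times values at `(tu, t²u, …)`. Inserting the product formula inductively leaves an
identity between theta functions of degree `s` in `u` (`partialFraction`), itself proved by a
dimension count. -/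

namespace EllipticBC

open Topology Filter

/-! ### Infinite products and the theta function -/

theorem summable_norm_geometric_mul {q : ℂ} (hq : ‖q‖ < 1) (z : ℂ) :
    Summable fun i : ℕ => ‖-(q ^ i * z)‖ := by
  simpa using (summable_geometric_of_lt_one (norm_nonneg _) hq).mul_right ‖z‖

theorem multipliable_one_sub_geometric_mul {q : ℂ} (hq : ‖q‖ < 1) (z : ℂ) :
    Multipliable fun i : ℕ => 1 - q ^ i * z := by
  simpa [sub_eq_add_neg] using multipliable_one_add_of_summable (summable_norm_geometric_mul hq z)

theorem differentiable_tprod_one_sub_geometric_mul {q : ℂ} (hq : ‖q‖ < 1) :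
    Differentiable ℂ fun z : ℂ => ∏' i : ℕ, (1 - q ^ i * z) := by
  have h : HasProdLocallyUniformlyOn (fun (i : ℕ) (z : ℂ) => 1 + -(q ^ i * z))
      (fun z => ∏' i : ℕ, (1 + -(q ^ i * z))) Set.univ := by
    apply hasProdLocallyUniformlyOn_of_forall_compact isOpen_univ
    intro K _ hcK
    obtain ⟨C, hC⟩ := hcK.isBounded.exists_norm_le
    refine ((summable_geometric_of_lt_one (norm_nonneg q) hq).mul_right
      C).hasProdUniformlyOn_nat_one_add hcK (.of_forall fun i x hx => ?_) (fun _ => by fun_prop)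
    simpa using mul_le_mul_of_nonneg_left (hC x hx) (pow_nonneg (norm_nonneg q) i)
  have h' := h.differentiableOn (.of_forall fun _ => by
    simpa [Finset.prod_fn] using DifferentiableOn.finsetProd (fun _ _ => by fun_prop)) isOpen_univ
  simpa [sub_eq_add_neg] using differentiableOn_univ.1 h'

theorem tprod_one_sub_geometric_mul {q : ℂ} (hq : ‖q‖ < 1) (z : ℂ) :
    ∏' i : ℕ, (1 - q ^ i * z) = (1 - z) * ∏' i : ℕ, (1 - q ^ i * (q * z)) := by
  rw [tprod_eq_zero_mul']
  · simp [pow_succ, mul_assoc]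
  · simpa [pow_succ, mul_assoc] using multipliable_one_sub_geometric_mul hq (q * z)

theorem tprod_one_sub_geometric_mul_eq_zero {q : ℂ} (hq : ‖q‖ < 1) {z : ℂ}
    (h : ∏' i : ℕ, (1 - q ^ i * z) = 0) : ∃ i : ℕ, q ^ i * z = 1 := by
  by_contra! hne
  refine tprod_one_add_ne_zero_of_summable (f := fun i : ℕ => -(q ^ i * z)) (fun i => ?_)
    (summable_norm_geometric_mul hq z) (by simpa [sub_eq_add_neg] using h)
  rw [← sub_eq_add_neg, sub_ne_zero]
  exact (hne i).symm

variable {p : ℂˣ}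

/-- The theta function as a function of a complex variable, holomorphic away from the origin. -/
noncomputable def thetaFun (p : ℂˣ) (z : ℂ) : ℂ :=
  (∏' i : ℕ, (1 - (p : ℂ) ^ i * z)) * ∏' i : ℕ, (1 - (p : ℂ) ^ i * ((p : ℂ) / z))

theorem thetaFun_coe (u : ℂˣ) : thetaFun p u = theta p u := rfl

theorem differentiableOn_thetaFun (hp : ‖(p : ℂ)‖ < 1) :
    DifferentiableOn ℂ (thetaFun p) {z | z ≠ 0} := by
  have h := differentiable_tprod_one_sub_geometric_mul hp
  refine h.differentiableOn.mul
    (h.comp_differentiableOn (f := fun z : ℂ => (p : ℂ) / z) fun z hz => ?_)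
  exact ((differentiableAt_const _).div differentiableAt_id hz.out).differentiableWithinAt

theorem theta_p_mul (hp : ‖(p : ℂ)‖ < 1) (u : ℂˣ) :
    theta p (p * u) = -(u : ℂ)⁻¹ * theta p u := by
  have h1 := tprod_one_sub_geometric_mul hp u
  have h2 := tprod_one_sub_geometric_mul hp ((u : ℂ)⁻¹)
  have h3 : (p : ℂ) / ((p : ℂ) * u) = (u : ℂ)⁻¹ := by field_simp
  have h4 : 1 - (u : ℂ)⁻¹ = -(u : ℂ)⁻¹ * (1 - u) := by field_simp; ring
  simp only [theta, Units.val_mul, h3, div_eq_mul_inv]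
  rw [h2, h1, h4]
  ring

/-- The two products in θ are exchanged by `u ↦ p/u`, so `θ(1/u) = θ(pu)`. -/
theorem theta_inv (hp : ‖(p : ℂ)‖ < 1) (u : ℂˣ) :
    theta p u⁻¹ = -(u : ℂ)⁻¹ * theta p u := by
  rw [← theta_p_mul hp]
  have h3 : (p : ℂ) / ((p : ℂ) * u) = (u : ℂ)⁻¹ := by field_simp
  simp only [theta, Units.val_mul, h3, Units.val_inv_eq_inv_val, div_inv_eq_mul]
  ring

theorem theta_one (p : ℂˣ) : theta p 1 = 0 := by
  have : ∏' i : ℕ, (1 - (p : ℂ) ^ i * ((1 : ℂˣ) : ℂ)) = 0 :=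
    tprod_of_exists_eq_zero ⟨0, by simp⟩
  rw [theta, this, zero_mul]

theorem mem_zpowers_of_theta_eq_zero (hp : ‖(p : ℂ)‖ < 1) {u : ℂˣ} (h : theta p u = 0) :
    u ∈ Subgroup.zpowers p := by
  rcases mul_eq_zero.1 h with h | h
  · obtain ⟨i, hi⟩ := tprod_one_sub_geometric_mul_eq_zero hp h
    refine ⟨-i, ?_⟩
    have : p ^ i * u = 1 := Units.ext (by simpa using hi)
    simpa using inv_eq_of_mul_eq_one_right this
  · obtain ⟨i, hi⟩ := tprod_one_sub_geometric_mul_eq_zero hp h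
    refine ⟨i + 1, ?_⟩
    have : p ^ i * (p / u) = 1 := Units.ext (by simpa using hi)
    rw [← mul_div_assoc, div_eq_one] at this
    rw [← this]
    exact_mod_cast pow_succ p i

/-- The zeros of θ lie in the countable set `p^ℤ`, and squaring has finite fibres, so only countably
many `ξ` are excluded. -/
theorem dense_theta_ne_zero (hp : ‖(p : ℂ)‖ < 1) {ι : Type*} [Finite ι] (β : ι → ℂˣ) :
    Dense {ξ : ℂˣ | ∀ i, theta p (β i * ξ ^ 2) ≠ 0} := by
  have hcount : {ξ : ℂˣ | ∃ i, theta p (β i * ξ ^ 2) = 0}.Countable := by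
    have hsub : {ξ : ℂˣ | ∃ i, theta p (β i * ξ ^ 2) = 0} ⊆
        ⋃ i, ⋃ k : ℤ, {ξ : ℂˣ | ξ ^ 2 = (β i)⁻¹ * p ^ k} := by
      rintro ξ ⟨i, hi⟩
      obtain ⟨k, hk⟩ := mem_zpowers_of_theta_eq_zero hp hi
      simp only [Set.mem_iUnion, Set.mem_ofPred_eq]
      exact ⟨i, k, by rw [show p ^ k = β i * ξ ^ 2 from hk]; group⟩
    refine (Set.countable_iUnion fun i => Set.countable_iUnion fun k => ?_).mono hsub
    generalize (β i)⁻¹ * p ^ k = b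
    rcases Set.eq_empty_or_nonempty {ξ : ℂˣ | ξ ^ 2 = b} with h | ⟨a, ha⟩
    · rw [h]; exact Set.countable_empty
    · refine (Set.Finite.subset (Set.toFinite {a, -a}) fun ξ hξ => ?_).countable
      have h : (ξ : ℂ) ^ 2 = (a : ℂ) ^ 2 := by
        simpa using congrArg Units.val (hξ.out.trans ha.out.symm)
      simpa [Units.ext_iff] using sq_eq_sq_iff_eq_or_eq_neg.1 h
  have hd := ((hcount.image (Units.val : ℂˣ → ℂ)).dense_compl ℝ).preimage
    Units.isOpenEmbedding_val.isOpenMap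
  refine hd.mono fun ξ hξ i h =>
    (Set.mem_compl_iff _ _).1 (Set.mem_preimage.1 hξ) (Set.mem_image_of_mem _ ?_)
  exact ⟨i, h⟩

/-- Continuous functions on `ℂˣ` that agree away from zeros of theta functions agree. -/
theorem eq_of_forall_theta_ne_zero (hp : ‖(p : ℂ)‖ < 1) {ι : Type*} [Finite ι] (β : ι → ℂˣ)
    {f g : ℂˣ → ℂ} (hf : Continuous f) (hg : Continuous g)
    (h : ∀ ξ : ℂˣ, (∀ i, theta p (β i * ξ ^ 2) ≠ 0) → f ξ = g ξ) : f = g :=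
  hf.ext_on (dense_theta_ne_zero hp β) hg h

theorem continuous_theta (hp : ‖(p : ℂ)‖ < 1) : Continuous (theta p) := by
  have h : Continuous fun u : ℂˣ => thetaFun p u :=
    (differentiableOn_thetaFun hp).continuousOn.comp_continuous Units.continuous_val
      fun u => u.ne_zero
  exact h

/-! ### Laurent coefficients on the punctured plane -/

open Real Metric

/-- The Laurent coefficient of index `k` at the origin, computed on the unit circle. -/
noncomputable def laurentCoeff (F : ℂ → ℂ) (k : ℤ) : ℂ :=
  circleAverage (fun z => z ^ (-k) * F z) 0 1

theorem circleAverage_comp_mul_left (G : ℂ → ℂ) (w : ℂ) :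
    circleAverage (fun z => G (w * z)) 0 1 = circleAverage G 0 ‖w‖ := by
  rw [circleAverage_eq_integral_add (f := G) w.arg, circleAverage]
  congr 2 with θ
  congr 1
  have h : circleMap 0 1 θ * w = circleMap 0 ‖w‖ (θ + w.arg) := by
    conv_lhs => rw [← Complex.norm_mul_exp_arg_mul_I w]
    simp only [circleMap, Complex.ofReal_add, add_mul, Complex.exp_add, Complex.ofReal_one]
    ring
  rw [← h, mul_comm]

theorem circleAverage_eq_of_differentiableOn {G : ℂ → ℂ} (hG : DifferentiableOn ℂ G {z | z ≠ 0})
    {r R : ℝ} (hr : 0 < r) (hR : r ≤ R) : circleAverage G 0 r = circleAverage G 0 R := by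
  rw [circleAverage_eq_circleIntegral hr.ne', circleAverage_eq_circleIntegral (hr.trans_le hR).ne',
    Complex.circleIntegral_sub_center_inv_smul_eq_of_differentiable_on_annulus_off_countable hr hR
      Set.countable_empty]
  · refine hG.continuousOn.mono fun z hz => ?_
    rintro rfl
    exact hz.2 (mem_ball_self hr)
  · intro z hz
    refine hG.differentiableAt (isOpen_ne.mem_nhds ?_)
    rintro rfl
    exact hz.1.2 (mem_closedBall_self hr.le)

/-- The argument of `w` only rotates the circle; its modulus changes the radius, which is harmless
by Cauchy's theorem on an annulus. -/
theorem circleAverage_comp_mul_left_of_differentiableOn {G : ℂ → ℂ}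
    (hG : DifferentiableOn ℂ G {z | z ≠ 0}) {w : ℂ} (hw : w ≠ 0) :
    circleAverage (fun z => G (w * z)) 0 1 = circleAverage G 0 1 := by
  rw [circleAverage_comp_mul_left]
  rcases le_total ‖w‖ 1 with h | h
  · exact circleAverage_eq_of_differentiableOn hG (norm_pos_iff.2 hw) h
  · exact (circleAverage_eq_of_differentiableOn hG one_pos h).symm

theorem laurentCoeff_comp_mul_left {F : ℂ → ℂ} (hF : DifferentiableOn ℂ F {z | z ≠ 0}) {w : ℂ}
    (hw : w ≠ 0) (k : ℤ) : laurentCoeff (fun z => F (w * z)) k = w ^ k * laurentCoeff F k := by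
  have hG : DifferentiableOn ℂ (fun z => z ^ (-k) * F z) {z | z ≠ 0} :=
    (differentiableOn_zpow _ _ (.inl (by simp))).mul hF
  rw [laurentCoeff, laurentCoeff, ← circleAverage_comp_mul_left_of_differentiableOn hG hw,
    ← smul_eq_mul, ← circleAverage_fun_smul]
  congr 1 with z
  rw [smul_eq_mul, mul_zpow, ← mul_assoc, ← mul_assoc, ← zpow_add₀ hw]
  simp

theorem laurentCoeff_zpow_mul {F : ℂ → ℂ} (m k : ℤ) :
    laurentCoeff (fun z => z ^ (-m) * F z) k = laurentCoeff F (k + m) := by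
  refine circleAverage_congr_sphere fun z hz => ?_
  have hz : z ≠ 0 := by rintro rfl; simp at hz
  simp only [← mul_assoc, ← zpow_add₀ hz, neg_add]

theorem laurentCoeff_comp_inv (F : ℂ → ℂ) (k : ℤ) :
    laurentCoeff (fun z => F z⁻¹) k = laurentCoeff F (-k) := by
  rw [laurentCoeff, ← circleAverage_zero_one_congr_inv, laurentCoeff]
  simp

theorem laurentCoeff_congr {F G : ℂ → ℂ} (h : ∀ z ≠ 0, F z = G z) (k : ℤ) :
    laurentCoeff F k = laurentCoeff G k := by
  refine circleAverage_congr_sphere fun z hz => ?_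
  have hz : z ≠ 0 := by rintro rfl; simp at hz
  simp only [h z hz]

theorem laurentCoeff_const_mul (a : ℂ) (F : ℂ → ℂ) (k : ℤ) :
    laurentCoeff (fun z => a * F z) k = a * laurentCoeff F k := by
  rw [laurentCoeff, laurentCoeff, ← smul_eq_mul, ← circleAverage_fun_smul]
  simp [mul_left_comm]

theorem laurentCoeff_add {F G : ℂ → ℂ} (hF : DifferentiableOn ℂ F {z | z ≠ 0})
    (hG : DifferentiableOn ℂ G {z | z ≠ 0}) (k : ℤ) :
    laurentCoeff (F + G) k = laurentCoeff F k + laurentCoeff G k := by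
  have key : ∀ {H : ℂ → ℂ}, DifferentiableOn ℂ H {z | z ≠ 0} →
      CircleIntegrable (fun z => z ^ (-k) * H z) 0 1 := fun hH => by
    refine ContinuousOn.circleIntegrable zero_le_one (ContinuousOn.mono
      ((differentiableOn_zpow _ _ (.inl (by simp))).mul hH).continuousOn fun z hz => ?_)
    rintro rfl
    simp at hz
  rw [laurentCoeff, laurentCoeff, laurentCoeff, ← circleAverage_add (key hF) (key hG)]
  congr 1 with z
  simp [mul_add]

/-- On the unit circle these are Fourier coefficients of a continuous function; the zero series is
summable, hence converges pointwise to that function. -/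
theorem eq_zero_at_one_of_laurentCoeff_eq_zero {F : ℂ → ℂ}
    (hF : DifferentiableOn ℂ F {z | z ≠ 0}) (h : ∀ k, laurentCoeff F k = 0) : F 1 = 0 := by
  have : Fact (0 < 2 * π) := ⟨two_pi_pos⟩
  have hc : Continuous fun x : AddCircle (2 * π) => F (AddCircle.toCircle x) :=
    hF.continuousOn.comp_continuous
      (continuous_subtype_val.comp AddCircle.continuous_toCircle) fun x => by simp
  let g : C(AddCircle (2 * π), ℂ) := ⟨_, hc⟩
  have hg : fourierCoeff g = 0 := by
    funext k
    rw [fourierCoeff_eq_intervalIntegral _ _ 0, zero_add, Pi.zero_apply, ← h k, laurentCoeff,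
      circleAverage, one_div]
    congr 2 with θ
    simp only [smul_eq_mul, g, ContinuousMap.coe_mk, circleMap,
      AddCircle.toCircle_apply_mk, Circle.coe_exp]
    have h1 : 2 * π / (2 * π) * θ = θ := by field_simp
    rw [h1]
    congr 1
    · rw [fourier_coe_apply, zero_add, Complex.ofReal_one, one_mul, ← Complex.exp_int_mul]
      congr 1
      push_cast
      field_simp
    · simp
  have hs := has_pointwise_sum_fourier_series_of_summable (f := g)
    (by rw [hg]; exact summable_zero) 0
  simpa [hg, g] using hs.unique (by simp [hg])

theorem eq_zero_of_laurentCoeff_eq_zero {F : ℂ → ℂ} (hF : DifferentiableOn ℂ F {z | z ≠ 0})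
    (h : ∀ k, laurentCoeff F k = 0) {w : ℂ} (hw : w ≠ 0) : F w = 0 := by
  have hF' : DifferentiableOn ℂ (fun z => F (w * z)) {z | z ≠ 0} :=
    hF.comp (differentiableOn_id.const_mul w) fun z hz => mul_ne_zero hw hz
  simpa using eq_zero_at_one_of_laurentCoeff_eq_zero hF' fun k => by
    rw [laurentCoeff_comp_mul_left hF hw, h, mul_zero]

/-! ### Quasi-periodic functions and dimension bounds -/

/-- Extension by zero of a function on `ℂˣ`. -/
noncomputable def extend (f : ℂˣ → ℂ) (z : ℂ) : ℂ :=
  if h : z = 0 then 0 else f (Units.mk0 z h)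

theorem extend_coe (f : ℂˣ → ℂ) (u : ℂˣ) : extend f u = f u := by simp [extend]

theorem extend_of_ne_zero (f : ℂˣ → ℂ) {z : ℂ} (hz : z ≠ 0) : extend f z = f (Units.mk0 z hz) := by
  simp [extend, hz]

theorem extend_add (f g : ℂˣ → ℂ) : extend (f + g) = extend f + extend g := by
  ext z; by_cases hz : z = 0 <;> simp [extend, hz]

theorem extend_smul (a : ℂ) (f : ℂˣ → ℂ) : extend (a • f) = fun z => a * extend f z := by
  ext z; by_cases hz : z = 0 <;> simp [extend, hz]

/-- Holomorphic functions `f` on `ℂˣ` with `f (p u) = κ u⁻ᵐ f u`. -/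
def quasiPeriodic (p : ℂˣ) (κ : ℂ) (m : ℕ) : Submodule ℂ (ℂˣ → ℂ) where
  carrier := {f | DifferentiableOn ℂ (extend f) {z | z ≠ 0} ∧
    ∀ u, f (p * u) = κ * ((u : ℂ) ^ (-(m : ℤ)) * f u)}
  zero_mem' := by
    refine ⟨(differentiableOn_const (0 : ℂ)).congr fun z _ => by simp [extend], by simp⟩
  add_mem' := by
    rintro f g ⟨hf, hf'⟩ ⟨hg, hg'⟩
    exact ⟨by rw [extend_add]; exact hf.add hg, fun u => by simp [hf', hg']; ring⟩
  smul_mem' := by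
    rintro a f ⟨hf, hf'⟩
    exact ⟨by rw [extend_smul]; exact hf.const_mul a, fun u => by simp [hf']; ring⟩

/-- The Laurent coefficient as a linear form. -/
noncomputable def laurentForm (p : ℂˣ) (κ : ℂ) (m : ℕ) (k : ℤ) : quasiPeriodic p κ m →ₗ[ℂ] ℂ where
  toFun f := laurentCoeff (extend f) k
  map_add' f g := by
    rw [Submodule.coe_add, extend_add, laurentCoeff_add f.2.1 g.2.1]
  map_smul' a f := by
    rw [Submodule.coe_smul, extend_smul, laurentCoeff_const_mul]; rfl

/-- Both sides are the `k`-th coefficient of `f(pz)`, computed by rescaling and by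
quasi-periodicity. -/
theorem laurentForm_recurrence {p : ℂˣ} {κ : ℂ} {m : ℕ} (f : quasiPeriodic p κ m) (k : ℤ) :
    (p : ℂ) ^ k * laurentForm p κ m k f = κ * laurentForm p κ m (k + m) f := by
  change _ * laurentCoeff _ _ = _ * laurentCoeff _ _
  rw [← laurentCoeff_comp_mul_left f.2.1 p.ne_zero, ← laurentCoeff_zpow_mul,
    ← laurentCoeff_const_mul]
  refine laurentCoeff_congr (fun z hz => ?_) k
  have h := f.2.2 (Units.mk0 z hz)
  have h' : extend f ((p : ℂ) * z) = (f : ℂˣ → ℂ) (p * Units.mk0 z hz) := by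
    rw [← extend_coe (f : ℂˣ → ℂ)]; simp
  rw [h', h, extend_of_ne_zero _ hz, Units.val_mk0]

theorem quasiPeriodic_eq_zero {p : ℂˣ} {κ : ℂ} {m : ℕ} {f : quasiPeriodic p κ m}
    (h : ∀ k, laurentForm p κ m k f = 0) : f = 0 := by
  ext u
  rw [← extend_coe (f : ℂˣ → ℂ)]
  exact eq_zero_of_laurentCoeff_eq_zero f.2.1 h u.ne_zero

theorem laurentForm_eq_zero_iff {p : ℂˣ} {κ : ℂ} (hκ : κ ≠ 0) {m : ℕ} (f : quasiPeriodic p κ m)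
    (k q : ℤ) : laurentForm p κ m (k + q * m) f = 0 ↔ laurentForm p κ m k f = 0 := by
  have step : ∀ k, laurentForm p κ m (k + m) f = 0 ↔ laurentForm p κ m k f = 0 := fun k => by
    have := laurentForm_recurrence f k
    have hp : (p : ℂ) ^ k ≠ 0 := zpow_ne_zero _ p.ne_zero
    constructor
    · intro h; rw [h, mul_zero] at this; exact (mul_eq_zero.1 this).resolve_left hp
    · intro h; rw [h, mul_zero] at this; exact (mul_eq_zero.1 this.symm).resolve_left hκ
  induction q using Int.induction_on with
  | zero => simp
  | succ i ih =>
    refine Iff.trans ?_ ((step (k + i * m)).trans ih)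
    rw [add_mul, one_mul, ← add_assoc]
  | pred i ih =>
    refine (step (k + (-i - 1) * m)).symm.trans (Iff.trans ?_ ih)
    rw [sub_mul, one_mul, add_assoc, sub_add_cancel]

theorem quasiPeriodic_eq_zero_of_window {p : ℂˣ} {κ : ℂ} (hκ : κ ≠ 0) {m : ℕ} (hm : 1 ≤ m)
    {f : quasiPeriodic p κ m} (a : ℤ) (h : ∀ k, a ≤ k → k < a + m → laurentForm p κ m k f = 0) :
    f = 0 := by
  refine quasiPeriodic_eq_zero fun k => ?_
  have hm' : (0 : ℤ) < m := by exact_mod_cast hm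
  have h1 := h (a + (k - a) % m) (by linarith [Int.emod_nonneg (k - a) hm'.ne'])
    (by linarith [Int.emod_lt_of_pos (k - a) hm'])
  rw [← laurentForm_eq_zero_iff hκ f _ ((k - a) / m)] at h1
  rwa [add_assoc, Int.emod_add_ediv_mul, add_sub_cancel] at h1

/-- `A` bounds the dimension of `V` above by `|ι|` and `B` bounds it below. -/
theorem bijective_of_injective_of_surjective {V ι : Type*} [AddCommGroup V] [Module ℂ V]
    [Finite ι] {A B : V →ₗ[ℂ] (ι → ℂ)} (hA : Function.Injective A) (hB : Function.Surjective B) :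
    Function.Bijective A ∧ Function.Bijective B := by
  have := Fintype.ofFinite ι
  have : FiniteDimensional ℂ V := Module.Finite.of_injective A hA
  have h : Module.finrank ℂ V = Module.finrank ℂ (ι → ℂ) :=
    le_antisymm (LinearMap.finrank_le_finrank_of_injective hA)
      (LinearMap.finrank_le_finrank_of_surjective hB)
  exact ⟨⟨hA, (LinearMap.injective_iff_surjective_of_finrank_eq_finrank h).1 hA⟩,
    ⟨(LinearMap.injective_iff_surjective_of_finrank_eq_finrank h).2 hB, hB⟩⟩

/-- Evaluation of the functions in `V` at a family of points. -/
def evalMap {X ι : Type*} (V : Submodule ℂ (X → ℂ)) (x : ι → X) : V →ₗ[ℂ] (ι → ℂ) :=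
  LinearMap.pi fun k => LinearMap.proj (x k) ∘ₗ V.subtype

theorem evalMap_apply {X ι : Type*} (V : Submodule ℂ (X → ℂ)) (x : ι → X) (f : V) (k : ι) :
    evalMap V x f k = (f : X → ℂ) (x k) := rfl

theorem evalMap_surjective {X ι : Type*} [Finite ι] {V : Submodule ℂ (X → ℂ)} (x : ι → X)
    (φ : ι → V) (hφ : ∀ k l, k ≠ l → (φ k : X → ℂ) (x l) = 0)
    (hφ' : ∀ k, (φ k : X → ℂ) (x k) ≠ 0) : Function.Surjective (evalMap V x) := fun y => by
  classical
  have := Fintype.ofFinite ι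
  refine ⟨∑ k, (y k / (φ k : X → ℂ) (x k)) • φ k, ?_⟩
  ext l
  rw [map_sum, Finset.sum_apply, Finset.sum_eq_single l]
  · simp [evalMap_apply, hφ' l]
  · intro k _ hk; simp [evalMap_apply, hφ k l hk]
  · simp

/-- In a space of functions of dimension at most `|ι|`, a family dual to the evaluations at some
points `x i` forces a function vanishing at all `x i` to vanish. -/
theorem eq_zero_of_dual_family {X ι : Type*} [Finite ι] {V : Submodule ℂ (X → ℂ)}
    {A : V →ₗ[ℂ] (ι → ℂ)} (hA : Function.Injective A) (x : ι → X) (φ : ι → V)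
    (hφ : ∀ k l, k ≠ l → (φ k : X → ℂ) (x l) = 0) (hφ' : ∀ k, (φ k : X → ℂ) (x k) ≠ 0)
    {f : V} (hf : ∀ k, (f : X → ℂ) (x k) = 0) : f = 0 :=
  (bijective_of_injective_of_surjective hA (evalMap_surjective x φ hφ hφ')).2.1
    (by ext k; simp [evalMap_apply, hf])

/-- A quasi-periodic function of degree `m` vanishing at `m` points vanishes identically if there
is a dual family for these points. -/
theorem quasiPeriodic_eq_zero_of_dual_family {p : ℂˣ} {κ : ℂ} (hκ : κ ≠ 0) {m : ℕ} (hm : 1 ≤ m)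
    (x : Fin m → ℂˣ) (φ : Fin m → quasiPeriodic p κ m)
    (hφ : ∀ k l, k ≠ l → (φ k : ℂˣ → ℂ) (x l) = 0) (hφ' : ∀ k, (φ k : ℂˣ → ℂ) (x k) ≠ 0)
    {f : quasiPeriodic p κ m} (hf : ∀ k, (f : ℂˣ → ℂ) (x k) = 0) : f = 0 := by
  let A : quasiPeriodic p κ m →ₗ[ℂ] (Fin m → ℂ) :=
    LinearMap.pi fun k => laurentForm p κ m ((k : ℕ) : ℤ)
  have hA : Function.Injective A := by
    rw [injective_iff_map_eq_zero]
    intro g hg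
    refine quasiPeriodic_eq_zero_of_window hκ hm 0 fun k h0 hk => ?_
    lift k to ℕ using h0
    exact congrFun hg ⟨k, by omega⟩
  exact eq_zero_of_dual_family hA x φ hφ hφ' hf

/-- The inversion-invariant functions in `quasiPeriodic p κ m`. -/
def evenQuasiPeriodic (p : ℂˣ) (κ : ℂ) (m : ℕ) : Submodule ℂ (ℂˣ → ℂ) where
  carrier := {f | f ∈ quasiPeriodic p κ m ∧ ∀ u, f u⁻¹ = f u}
  zero_mem' := ⟨zero_mem _, by simp⟩
  add_mem' := by rintro f g ⟨hf, hf'⟩ ⟨hg, hg'⟩; exact ⟨add_mem hf hg, by simp [hf', hg']⟩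
  smul_mem' := by rintro a f ⟨hf, hf'⟩; exact ⟨Submodule.smul_mem _ a hf, by simp [hf']⟩

theorem evenQuasiPeriodic_eq_zero_of_dual_family {p : ℂˣ} (hp : ‖(p : ℂ)‖ < 1) {s : ℕ}
    (hs : 1 ≤ s) {m : ℕ} (hm : m = 2 * (s - 1)) {κ : ℂ} (hκ : κ ≠ 0) (hκ' : s = 1 → κ = 1)
    (x : Fin s → ℂˣ) (φ : Fin s → evenQuasiPeriodic p κ m)
    (hφ : ∀ k l, k ≠ l → (φ k : ℂˣ → ℂ) (x l) = 0) (hφ' : ∀ k, (φ k : ℂˣ → ℂ) (x k) ≠ 0)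
    {f : evenQuasiPeriodic p κ m} (hf : ∀ k, (f : ℂˣ → ℂ) (x k) = 0) : f = 0 := by
  let incl : evenQuasiPeriodic p κ m →ₗ[ℂ] quasiPeriodic p κ m :=
    Submodule.inclusion fun g hg => hg.1
  let A : evenQuasiPeriodic p κ m →ₗ[ℂ] (Fin s → ℂ) :=
    LinearMap.pi fun k => laurentForm p κ m ((k : ℕ) : ℤ) ∘ₗ incl
  have hA : Function.Injective A := by
    rw [injective_iff_map_eq_zero]
    intro g hg
    have hk : ∀ k : ℕ, k < s → laurentForm p κ m k (incl g) = 0 := fun k hk =>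
      congrFun hg ⟨k, hk⟩
    have heven : ∀ k : ℤ, laurentForm p κ m (-k) (incl g) = laurentForm p κ m k (incl g) := by
      intro k
      change laurentCoeff _ _ = laurentCoeff _ _
      rw [← laurentCoeff_comp_inv]
      refine laurentCoeff_congr (fun z hz => ?_) k
      rw [extend_of_ne_zero _ hz, extend_of_ne_zero _ (inv_ne_zero hz)]
      exact (congrArg (g : ℂˣ → ℂ) (by ext; simp)).trans (g.2.2 (Units.mk0 z hz))
    have hzero : incl g = 0 := by
      rcases hs.eq_or_lt with h1 | h1
      -- For `s = 1` the degree is 0 and the recurrence does not link different indices; it reads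
      -- `(pᵏ - 1) aₖ = 0`, which kills every `k ≠ 0`.
      · refine quasiPeriodic_eq_zero fun k => ?_
        rcases eq_or_ne k 0 with rfl | hk0
        · exact hk 0 hs
        · have hrec := laurentForm_recurrence (incl g) k
          have hm0 : m = 0 := by omega
          have hpk : (p : ℂ) ^ k ≠ 1 := fun h => by
            have h2 : ‖(p : ℂ)‖ ^ k = 1 := by rw [← norm_zpow, h, norm_one]
            exact hk0 ((zpow_eq_one_iff_right₀ (norm_nonneg _) hp.ne).1 h2)
          have h4 : ((p : ℂ) ^ k - 1) * laurentForm p κ m k (incl g) = 0 := by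
            have h5 : k + (m : ℤ) = k := by simp [hm0]
            rw [sub_mul, hrec, h5, ← sub_mul, sub_eq_zero.2 (hκ' h1.symm), zero_mul]
          exact (mul_eq_zero.1 h4).resolve_left (sub_ne_zero.2 hpk)
      -- The window `-(s-1), …, s-2` has length `2(s-1)`, and evenness folds it into `0, …, s-1`.
      · refine quasiPeriodic_eq_zero_of_window hκ (by omega) (-((s - 1 : ℕ) : ℤ)) fun k h2 h3 => ?_
        rcases le_total 0 k with h0 | h0
        · lift k to ℕ using h0
          exact hk k (by omega)
        · rw [← heven]
          obtain ⟨j, rfl⟩ : ∃ j : ℕ, k = -j := ⟨k.natAbs, by omega⟩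
          rw [neg_neg]
          exact hk j (by omega)
    ext u
    exact congrFun (congrArg Subtype.val hzero) u
  exact eq_zero_of_dual_family hA x φ hφ hφ' hf

/-! ### Lagrange interpolation in one variable -/

theorem e_inv_left {p : ℂˣ} (hp : ‖(p : ℂ)‖ < 1) (u v : ℂˣ) : e p u⁻¹ v = e p u v := by
  have h1 := theta_inv hp (u / v)
  have h2 := theta_inv hp (u * v)
  rw [e, e, show u⁻¹ / v = (u * v)⁻¹ by rw [mul_inv, div_eq_mul_inv],
    show u⁻¹ * v = (u / v)⁻¹ by rw [inv_div, div_eq_mul_inv, mul_comm], h1, h2]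
  simp only [Units.val_inv_eq_inv_val, Units.val_div_eq_div_val, Units.val_mul]
  field_simp

theorem e_p_mul_left {p : ℂˣ} (hp : ‖(p : ℂ)‖ < 1) (u v : ℂˣ) :
    e p (p * u) v = ((p : ℂ) * (u : ℂ) ^ 2)⁻¹ * e p u v := by
  rw [e, e, mul_assoc p, mul_div_assoc p, theta_p_mul hp, theta_p_mul hp]
  simp only [Units.val_div_eq_div_val, Units.val_mul]
  field_simp

theorem e_self (p u : ℂˣ) : e p u u = 0 := by simp [e, theta_one]

theorem differentiableOn_extend_theta {p : ℂˣ} (hp : ‖(p : ℂ)‖ < 1) (a : ℂˣ) :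
    DifferentiableOn ℂ (extend fun u => theta p (u * a)) {z | z ≠ 0} := by
  refine ((differentiableOn_thetaFun hp).comp (differentiableOn_id.mul_const (a : ℂ))
    fun z hz => mul_ne_zero hz.out a.ne_zero).congr fun z hz => ?_
  rw [extend_of_ne_zero _ hz.out, ← thetaFun_coe]
  rfl

theorem differentiableOn_extend_prod {ι : Type*} (S : Finset ι) {f : ι → ℂˣ → ℂ}
    (hf : ∀ i ∈ S, DifferentiableOn ℂ (extend (f i)) {z | z ≠ 0}) :
    DifferentiableOn ℂ (extend fun u => ∏ i ∈ S, f i u) {z | z ≠ 0} := by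
  refine (DifferentiableOn.finsetProd hf).congr fun z hz => ?_
  simp [extend_of_ne_zero _ hz.out]

theorem differentiableOn_extend_e {p : ℂˣ} (hp : ‖(p : ℂ)‖ < 1) (a : ℂˣ) :
    DifferentiableOn ℂ (extend fun u => e p u a) {z | z ≠ 0} := by
  refine (((differentiableOn_inv).mul (differentiableOn_extend_theta hp a)).mul
    (differentiableOn_extend_theta hp a⁻¹)).congr fun z hz => ?_
  simp [extend_of_ne_zero _ hz.out, e, div_eq_mul_inv]

/-- The Lagrange interpolation functions of the one-variable space `H_{s-1,1}`. -/
noncomputable def lagrange (p : ℂˣ) {s : ℕ} (c : Fin s → ℂˣ) (k : Fin s) (w : ℂˣ) : ℂ :=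
  ∏ j ∈ Finset.univ.erase k, (e p w (c j) / e p (c k) (c j))

section Lagrange

variable {p : ℂˣ} {s : ℕ} {c : Fin s → ℂˣ}

theorem lagrange_self (hc : ∀ k l, k ≠ l → e p (c k) (c l) ≠ 0) (k : Fin s) :
    lagrange p c k (c k) = 1 :=
  Finset.prod_eq_one fun j hj => div_self (hc k j (Finset.ne_of_mem_erase hj).symm)

theorem lagrange_of_ne {k l : Fin s} (h : k ≠ l) : lagrange p c k (c l) = 0 :=
  Finset.prod_eq_zero (Finset.mem_erase.2 ⟨h.symm, Finset.mem_univ l⟩) (by simp [e_self])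

theorem lagrange_inv (hp : ‖(p : ℂ)‖ < 1) (k : Fin s) (w : ℂˣ) :
    lagrange p c k w⁻¹ = lagrange p c k w := by
  simp [lagrange, e_inv_left hp]

theorem lagrange_p_mul (hp : ‖(p : ℂ)‖ < 1) (k : Fin s) (w : ℂˣ) :
    lagrange p c k (p * w) =
      lagrange p c k w * ((p : ℂ) * (w : ℂ) ^ 2) ^ (-(s : ℤ) + 1) := by
  have hs : 1 ≤ s := k.pos
  simp only [lagrange, e_p_mul_left hp, mul_div_assoc]
  rw [Finset.prod_mul_distrib, Finset.prod_const, Finset.card_erase_of_mem (Finset.mem_univ k),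
    Finset.card_univ, Fintype.card_fin, mul_comm, inv_pow, ← zpow_natCast, ← zpow_neg]
  congr 2
  omega

theorem differentiableOn_extend_lagrange (hp : ‖(p : ℂ)‖ < 1) (k : Fin s) :
    DifferentiableOn ℂ (extend (lagrange p c k)) {z | z ≠ 0} := by
  refine differentiableOn_extend_prod _ fun j _ => ?_
  refine ((differentiableOn_extend_e hp (c j)).div_const (e p (c k) (c j))).congr fun z hz => ?_
  simp [extend_of_ne_zero _ hz.out]

theorem mem_evenQuasiPeriodic {f : ℂˣ → ℂ} (hs : 1 ≤ s)
    (hf : DifferentiableOn ℂ (extend f) {z | z ≠ 0}) (hinv : ∀ u, f u⁻¹ = f u)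
    (hper : ∀ u, f (p * u) = f u * ((p : ℂ) * (u : ℂ) ^ 2) ^ (-(s : ℤ) + 1)) :
    f ∈ evenQuasiPeriodic p ((p : ℂ) ^ (-(s : ℤ) + 1)) (2 * (s - 1)) := by
  refine ⟨⟨hf, fun u => ?_⟩, hinv⟩
  rw [hper, mul_zpow, ← zpow_natCast, ← zpow_mul]
  have : ((2 : ℕ) : ℤ) * (-(s : ℤ) + 1) = -((2 * (s - 1) : ℕ) : ℤ) := by
    push_cast [Nat.cast_sub hs]; ring
  rw [this]
  ring

/-- The difference of the two sides vanishes at every `cₖ`, where the Lagrange functions are a dual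
family. -/
theorem eq_sum_lagrange (hp : ‖(p : ℂ)‖ < 1) (hs : 1 ≤ s)
    (hc : ∀ k l, k ≠ l → e p (c k) (c l) ≠ 0) {f : ℂˣ → ℂ}
    (hf : f ∈ evenQuasiPeriodic p ((p : ℂ) ^ (-(s : ℤ) + 1)) (2 * (s - 1))) (w : ℂˣ) :
    f w = ∑ k, lagrange p c k w * f (c k) := by
  let φ : Fin s → evenQuasiPeriodic p ((p : ℂ) ^ (-(s : ℤ) + 1)) (2 * (s - 1)) := fun k =>
    ⟨lagrange p c k, mem_evenQuasiPeriodic hs (differentiableOn_extend_lagrange hp k)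
      (lagrange_inv hp k) (lagrange_p_mul hp k)⟩
  have h := evenQuasiPeriodic_eq_zero_of_dual_family hp hs rfl (zpow_ne_zero _ p.ne_zero)
    (by rintro rfl; simp) c φ (fun k l hkl => lagrange_of_ne hkl)
    (fun k => by simp [φ, lagrange_self hc]) (f := ⟨f, hf⟩ - ∑ k, f (c k) • φ k) fun l => ?_
  · have h' := congrFun (congrArg Subtype.val h) w
    simp only [AddSubgroupClass.coe_sub, Submodule.coe_sum, Submodule.coe_smul, Pi.sub_apply,
      Finset.sum_apply, Pi.smul_apply, smul_eq_mul, ZeroMemClass.coe_zero, Pi.zero_apply,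
      sub_eq_zero, φ] at h'
    rw [h']
    exact Finset.sum_congr rfl fun k _ => mul_comm _ _
  · simp only [AddSubgroupClass.coe_sub, Submodule.coe_sum, Submodule.coe_smul, Pi.sub_apply,
      Finset.sum_apply, Pi.smul_apply, smul_eq_mul, φ]
    rw [Finset.sum_eq_single l (fun k _ hk => by rw [lagrange_of_ne hk, mul_zero]) (by simp),
      lagrange_self hc, mul_one, sub_self]

end Lagrange

/-! ### Reference points and the interpolation basis -/

/-- A symmetric function sees only the multiset of coordinates. Writing multisets as sums of
singletons lets reference points be compared by manipulating finite sums, without explicit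
permutations. -/
theorem apply_eq_of_sum_singleton_eq {X Y : Type*} {n : ℕ} {f : (Fin n → X) → Y}
    (hf : ∀ (σ : Equiv.Perm (Fin n)) z, f (z ∘ σ) = f z) {z w : Fin n → X}
    (h : ∑ j, ({z j} : Multiset X) = ∑ j, {w j}) : f z = f w := by
  classical
  have hcard : ∀ x, Fintype.card {j // z j = x} = Fintype.card {j // w j = x} := fun x => by
    have := congrArg (Multiset.count x) h
    simpa [Multiset.count_sum', Multiset.count_singleton, Fintype.card_subtype, eq_comm] using this
  let σ : Equiv.Perm (Fin n) := Equiv.ofFiberEquiv fun x => Fintype.equivOfCardEq (hcard x)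
  have hσ : w ∘ σ = z := funext fun j => Equiv.ofFiberEquiv_map _ j
  rw [← hσ, hf]

theorem sum_singleton_refPoint (t : ℂˣ) {s n : ℕ} (c : Fin s → ℂˣ) (μ : Z s n) :
    ∑ j, ({refPoint t c μ j} : Multiset ℂˣ) = ∑ i, ∑ a ∈ Finset.range (μ.1 i), {t ^ a * c i} := by
  rw [← Equiv.sum_comp (finSigmaFinEquiv.trans (finCongr μ.2))]
  have h : ∀ x, refPoint t c μ ((finSigmaFinEquiv.trans (finCongr μ.2)) x) =
      t ^ (x.2 : ℕ) * c x.1 := fun x =>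
    congrArg (fun q : (i : Fin s) × Fin (μ.1 i) => t ^ (q.2 : ℕ) * c q.1)
      (finSigmaFinEquiv.symm_apply_apply x)
  simp only [h, Fintype.sum_sigma, Finset.sum_range]

/-- The multi-index `μ + ε_k`. -/
def addUnit {s n : ℕ} (μ : Z s n) (k : Fin s) : Z s (n + 1) :=
  ⟨μ.1 + Pi.single k 1, by simp [Finset.sum_add_distrib, μ.2]⟩

/-- The parameters with `c_k` replaced by `t c_k`. -/
def shift (t : ℂˣ) {s : ℕ} (c : Fin s → ℂˣ) (k : Fin s) : Fin s → ℂˣ :=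
  Function.update c k (t * c k)

/-- The string `cₖ, tcₖ, …` of length `μₖ + 1` is `cₖ` followed by the string of length `μₖ`
starting at `tcₖ`. -/
theorem sum_singleton_refPoint_addUnit (t : ℂˣ) {s n : ℕ} (c : Fin s → ℂˣ) (μ : Z s n)
    (k : Fin s) : ∑ j, ({refPoint t c (addUnit μ k) j} : Multiset ℂˣ) =
      ∑ j, {(Fin.cons (c k) (refPoint t (shift t c k) μ) : Fin (n + 1) → ℂˣ) j} := by
  rw [Fin.sum_univ_succ fun j => ({(Fin.cons (c k) (refPoint t (shift t c k) μ) :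
    Fin (n + 1) → ℂˣ) j} : Multiset ℂˣ)]
  simp only [Fin.cons_zero, Fin.cons_succ]
  rw [sum_singleton_refPoint, sum_singleton_refPoint,
    ← Finset.add_sum_erase _ _ (Finset.mem_univ k), ← Finset.add_sum_erase _ _ (Finset.mem_univ k),
    ← add_assoc]
  congr 1
  · have h : (addUnit μ k).1 k = μ.1 k + 1 := by simp [addUnit]
    rw [h, Finset.sum_range_succ', add_comm]
    simp [shift, pow_succ, mul_assoc]
  · refine Finset.sum_congr rfl fun i hi => ?_
    have hi := Finset.ne_of_mem_erase hi
    simp [addUnit, shift, hi]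

/-- The genericity condition on the parameters. -/
def Generic (p t : ℂˣ) {s : ℕ} (c : Fin s → ℂˣ) (n : ℕ) : Prop :=
  ∀ k l : Fin s, k ≠ l → ∀ i j : ℕ, i + j < n → e p (t ^ i * c k) (t ^ j * c l) ≠ 0

section Generic

variable {p t : ℂˣ} {s n : ℕ} {c : Fin s → ℂˣ}

/-- Since the two indices are distinct, at most one exponent grows by 1; this is paid for by
lowering `n + 1` to `n`. -/
theorem Generic.shift (h : Generic p t c (n + 1)) (k : Fin s) : Generic p t (shift t c k) n := by
  intro a b hab i j hij
  have key : ∀ (d : Fin s) (i : ℕ), t ^ i * EllipticBC.shift t c k d =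
      t ^ (if d = k then i + 1 else i) * c d := fun d i => by
    rcases eq_or_ne d k with rfl | hd
    · simp [EllipticBC.shift, pow_succ, mul_assoc]
    · simp [EllipticBC.shift, hd]
  rw [key, key]
  refine h a b hab _ _ ?_
  split_ifs with h1 h2
  · exact absurd (h1.trans h2.symm) hab
  all_goals omega

theorem Generic.ne_zero (h : Generic p t c n) (hn : 0 < n) (k l : Fin s) (hkl : k ≠ l) :
    e p (c k) (c l) ≠ 0 := by
  simpa using h k l hkl 0 0 (by simpa using hn)

theorem cons_left_mem (hs : 1 ≤ s) {f : (Fin (n + 1) → ℂˣ) → ℂ}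
    (hf : f ∈ thetaSpace p s (n + 1)) (z : Fin n → ℂˣ) :
    (fun w => f (Fin.cons w z)) ∈
      evenQuasiPeriodic p ((p : ℂ) ^ (-(s : ℤ) + 1)) (2 * (s - 1)) := by
  obtain ⟨⟨F, hF, hFf⟩, -, hinv, hper⟩ := hf
  refine mem_evenQuasiPeriodic hs ?_ (fun u => ?_) fun u => ?_
  · have hd : DifferentiableOn ℂ
        (fun w : ℂ => F (Fin.cons w fun i => (z i : ℂ) : Fin (n + 1) → ℂ)) {w | w ≠ 0} := by
      refine hF.comp (differentiableOn_pi.2 fun i => ?_) fun w hw i => ?_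
      · refine Fin.cases ?_ (fun i => ?_) i
        · exact differentiableOn_id
        · simp
      · refine Fin.cases ?_ (fun i => ?_) i
        · simpa using hw
        · simp
    refine hd.congr fun w hw => ?_
    rw [extend_of_ne_zero _ hw.out, ← hFf]
    congr 1
    funext i
    refine Fin.cases ?_ (fun i => ?_) i <;> simp
  · simpa using hinv 0 (Fin.cons u z)
  · simpa using hper 0 (Fin.cons u z)

theorem cons_right_mem {f : (Fin (n + 1) → ℂˣ) → ℂ}
    (hf : f ∈ thetaSpace p s (n + 1)) (w : ℂˣ) :
    (fun z : Fin n → ℂˣ => f (Fin.cons w z)) ∈ thetaSpace p s n := by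
  obtain ⟨⟨F, hF, hFf⟩, hperm, hinv, hper⟩ := hf
  refine ⟨⟨fun z => F (Fin.cons (w : ℂ) z : Fin (n + 1) → ℂ), ?_, fun z => ?_⟩, fun σ z => ?_,
    fun i z => ?_, fun i z => ?_⟩
  · refine hF.comp (differentiableOn_pi.2 fun i => ?_) fun z hz i => ?_
    · refine Fin.cases ?_ (fun i => ?_) i
      · simp
      · simpa using (differentiable_apply i).differentiableOn
    · refine Fin.cases ?_ (fun i => ?_) i
      · simp
      · simpa using hz.out i
  · change _ = f (Fin.cons w z)
    rw [← hFf]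
    change F _ = F _
    congr 1
    funext i
    refine Fin.cases ?_ (fun i => ?_) i <;> simp
  · refine apply_eq_of_sum_singleton_eq hperm ?_
    simp only [Fin.sum_univ_succ, Fin.cons_zero, Fin.cons_succ, Function.comp_apply]
    rw [Equiv.sum_comp σ fun j => ({z j} : Multiset ℂˣ)]
  · simpa [Fin.cons_update] using hinv i.succ (Fin.cons w z)
  · simpa [Fin.cons_update] using hper i.succ (Fin.cons w z)

theorem apply_cons_eq_sum_lagrange (hp : ‖(p : ℂ)‖ < 1) (hs : 1 ≤ s) (hc : Generic p t c (n + 1))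
    {f : (Fin (n + 1) → ℂˣ) → ℂ} (hf : f ∈ thetaSpace p s (n + 1)) (w : ℂˣ) (z : Fin n → ℂˣ) :
    f (Fin.cons w z) = ∑ k, lagrange p c k w * f (Fin.cons (c k) z) :=
  eq_sum_lagrange hp hs (hc.ne_zero n.succ_pos) (cons_left_mem hs hf z) w

theorem apply_refPoint_addUnit {f : (Fin (n + 1) → ℂˣ) → ℂ} (hf : f ∈ thetaSpace p s (n + 1))
    (k : Fin s) (ν : Z s n) :
    f (Fin.cons (c k) (refPoint t (EllipticBC.shift t c k) ν)) = f (refPoint t c (addUnit ν k)) :=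
  (apply_eq_of_sum_singleton_eq hf.2.1 (sum_singleton_refPoint_addUnit t c ν k)).symm

/-- A function in `H_{s-1,n}` vanishing at all the reference points vanishes. -/
theorem eq_zero_of_refPoint (hp : ‖(p : ℂ)‖ < 1) (hs : 1 ≤ s) (hc : Generic p t c n)
    {f : (Fin n → ℂˣ) → ℂ} (hf : f ∈ thetaSpace p s n)
    (h : ∀ ν : Z s n, f (refPoint t c ν) = 0) : f = 0 := by
  induction n generalizing c with
  | zero =>
    funext z
    exact (congrArg f (Subsingleton.elim _ _)).trans (h ⟨0, by simp⟩)
  | succ n ih =>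
    funext z
    -- Each `f(cₖ, ·)` vanishes at the reference points of the shifted parameters, so the induction
    -- hypothesis applies to it.
    rw [← Fin.cons_self_tail z, apply_cons_eq_sum_lagrange hp hs hc hf]
    refine Finset.sum_eq_zero fun k _ => ?_
    rw [show f (Fin.cons (c k) (Fin.tail z)) = 0 from congrFun (ih (hc.shift k)
      (cons_right_mem hf (c k)) fun ν => by rw [apply_refPoint_addUnit hf, h]) (Fin.tail z),
      mul_zero]

/-- The content of a word `κ`: the number of occurrences of each letter. -/
def content {s n : ℕ} (κ : Fin n → Fin s) : Z s n :=
  ⟨fun i => ∑ j, if κ j = i then 1 else 0, by rw [Finset.sum_comm]; simp⟩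

theorem content_comp_perm (κ : Fin n → Fin s) (σ : Equiv.Perm (Fin n)) :
    content (κ ∘ σ) = content κ :=
  Subtype.ext <| funext fun i => Equiv.sum_comp σ fun j => if κ j = i then 1 else 0

theorem content_surjective : Function.Surjective (content : (Fin n → Fin s) → Z s n) := fun μ => by
  refine ⟨fun j => (finSigmaFinEquiv.symm (Fin.cast μ.2.symm j)).1, Subtype.ext <| funext fun i => ?_⟩
  change ∑ j : Fin n, (if (finSigmaFinEquiv.symm (Fin.cast μ.2.symm j)).1 = i then 1 else 0) = μ.1 i
  rw [← Equiv.sum_comp (finSigmaFinEquiv.trans (finCongr μ.2))]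
  have h : ∀ x, (finSigmaFinEquiv.symm (Fin.cast μ.2.symm
      ((finSigmaFinEquiv.trans (finCongr μ.2)) x))).1 = x.1 := fun x =>
    congrArg Sigma.fst (finSigmaFinEquiv.symm_apply_apply x)
  simp only [h, Fintype.sum_sigma]
  rw [Finset.sum_eq_single i (fun x _ hx => by simp [hx]) (by simp)]
  simp

instance : Finite (Z s n) := Finite.of_surjective content content_surjective

/-- Symmetrized products of Lagrange functions. -/
noncomputable def monomialLagrange (p : ℂˣ) {s n : ℕ} (c : Fin s → ℂˣ) (μ : Z s n)
    (z : Fin n → ℂˣ) : ℂ :=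
  ∑ κ : Fin n → Fin s, if content κ = μ then ∏ j, lagrange p c (κ j) (z j) else 0

theorem monomialLagrange_mem (hp : ‖(p : ℂ)‖ < 1) (μ : Z s n) :
    monomialLagrange p c μ ∈ thetaSpace p s n := by
  refine ⟨⟨fun z => ∑ κ : Fin n → Fin s, if content κ = μ then
    ∏ j, extend (lagrange p c (κ j)) (z j) else 0, ?_, fun z => ?_⟩, fun σ z => ?_, fun i z => ?_,
    fun i z => ?_⟩
  · refine DifferentiableOn.fun_sum fun κ _ => ?_
    split_ifs
    · suffices h : DifferentiableOn ℂ (∏ j, fun z : Fin n → ℂ => extend (lagrange p c (κ j)) (z j))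
          {z | ∀ i, z i ≠ 0} by simpa [Finset.prod_fn] using h
      refine Finset.prod_induction (fun j (z : Fin n → ℂ) => extend (lagrange p c (κ j)) (z j))
        (DifferentiableOn ℂ · _) (fun _ _ => .mul) (differentiableOn_const 1) fun j _ => ?_
      exact (differentiableOn_extend_lagrange hp (κ j)).comp
        (differentiable_apply j).differentiableOn fun z hz => hz.out j
    · exact differentiableOn_const _
  · simp [extend_coe, monomialLagrange]
  · refine Fintype.sum_equiv (Equiv.arrowCongr σ (Equiv.refl _)) _ _ fun κ => ?_
    have hκ : (Equiv.arrowCongr σ (Equiv.refl (Fin s))) κ = κ ∘ σ.symm := rfl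
    rw [hκ, content_comp_perm]
    congr 1
    rw [← Equiv.prod_comp σ fun j => lagrange p c ((κ ∘ σ.symm) j) (z j)]
    simp
  · refine Finset.sum_congr rfl fun κ _ => ?_
    congr 1
    refine Finset.prod_congr rfl fun j _ => ?_
    rcases eq_or_ne j i with rfl | hj
    · simp [lagrange_inv hp]
    · simp [hj]
  · rw [monomialLagrange, monomialLagrange, Finset.sum_mul]
    refine Finset.sum_congr rfl fun κ _ => ?_
    rw [ite_mul, zero_mul]
    congr 1
    rw [← Finset.mul_prod_erase _ _ (Finset.mem_univ i),
      ← Finset.mul_prod_erase _ _ (Finset.mem_univ i), Function.update_self, lagrange_p_mul hp,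
      mul_right_comm]
    congr 2
    exact Finset.prod_congr rfl fun j hj => by
      rw [Function.update_of_ne (Finset.ne_of_mem_erase hj)]

theorem monomialLagrange_apply (hc : Generic p t c n) (μ : Z s n) (κ : Fin n → Fin s) :
    monomialLagrange p c μ (c ∘ κ) = if content κ = μ then 1 else 0 := by
  rw [monomialLagrange, Finset.sum_eq_single κ]
  · congr 1
    exact Finset.prod_eq_one fun j _ => lagrange_self (hc.ne_zero j.pos) (κ j)
  · intro κ' _ hκ'
    obtain ⟨j, hj⟩ := Function.ne_iff.1 hκ'
    rw [Finset.prod_eq_zero (Finset.mem_univ j) (lagrange_of_ne hj), ite_self]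
  · simp

/-- Evaluation at the reference points is an isomorphism. -/
theorem evalMap_refPoint_bijective (hp : ‖(p : ℂ)‖ < 1) (hs : 1 ≤ s) (hc : Generic p t c n) :
    Function.Bijective (evalMap (thetaSpace p s n) (refPoint t c)) := by
  have hinj : Function.Injective (evalMap (thetaSpace p s n) (refPoint t c)) := by
    rw [injective_iff_map_eq_zero]
    exact fun f hf => Subtype.ext (eq_zero_of_refPoint hp hs hc f.2 fun ν => congrFun hf ν)
  -- The lower bound on the dimension uses the points `c ∘ κ`, one word per content, instead of the
  -- reference points: there the symmetrized products are exactly dual.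
  choose κ hκ using content_surjective (s := s) (n := n)
  refine (bijective_of_injective_of_surjective hinj (evalMap_surjective (fun μ => c ∘ κ μ)
    (fun μ => ⟨monomialLagrange p c μ, monomialLagrange_mem hp μ⟩) (fun μ ν hμν => ?_)
    fun μ => ?_)).1
  · simp [monomialLagrange_apply hc, hκ, hμν.symm]
  · simp [monomialLagrange_apply hc, hκ]

theorem existsUnique_interpolationBasis (hp : ‖(p : ℂ)‖ < 1) (hs : 1 ≤ s)
    (hc : Generic p t c n) : ∃! E : Module.Basis (Z s n) ℂ (thetaSpace p s n),
      IsInterpolationBasis p t c E := by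
  have hb := evalMap_refPoint_bijective hp hs hc
  have key : ∀ E : Module.Basis (Z s n) ℂ (thetaSpace p s n), IsInterpolationBasis p t c E ↔
      ∀ μ, evalMap _ (refPoint t c) (E μ) = Pi.single μ 1 := fun E => by
    simp only [funext_iff, Pi.single_apply, evalMap_apply, IsInterpolationBasis, eq_comm]
  refine ⟨Module.Basis.ofEquivFun (LinearEquiv.ofBijective _ hb), ?_, fun E hE => ?_⟩
  · refine (key _).2 fun μ => ?_
    rw [Module.Basis.coe_ofEquivFun]
    exact (LinearEquiv.ofBijective _ hb).apply_symm_apply _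
  · refine Module.Basis.eq_of_apply_eq fun μ => hb.1 ?_
    rw [(key E).1 hE, Module.Basis.coe_ofEquivFun]
    exact ((LinearEquiv.ofBijective _ hb).apply_symm_apply _).symm

end Generic

/-! ### Odd theta functions and partial fractions -/

section Odd

variable {p : ℂˣ}

theorem odd_inv (hp : ‖(p : ℂ)‖ < 1) (ξ : ℂˣ) : odd p ξ⁻¹ = -odd p ξ := by
  rw [odd, odd, inv_pow, theta_inv hp]
  simp only [Units.val_inv_eq_inv_val, Units.val_pow_eq_pow_val]
  field_simp

theorem odd_one (p : ℂˣ) : odd p 1 = 0 := by simp [odd, theta_one]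

theorem odd_ne_zero {ξ : ℂˣ} : odd p ξ ≠ 0 ↔ theta p (ξ ^ 2) ≠ 0 := by simp [odd]

theorem continuous_odd (hp : ‖(p : ℂ)‖ < 1) : Continuous (odd p) := by
  have h : Continuous fun ξ : ℂˣ => ((ξ⁻¹ : ℂˣ) : ℂ) * theta p (ξ ^ 2) :=
    (Units.continuous_val.comp continuous_inv).mul ((continuous_theta hp).comp (continuous_pow 2))
  simp only [Units.val_inv_eq_inv_val] at h
  exact h

theorem e_sq (p υ γ : ℂˣ) : e p (υ ^ 2) (γ ^ 2) = odd p (υ * γ) * odd p (υ / γ) := by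
  rw [e, odd, odd, ← mul_pow, ← div_pow]
  simp only [Units.val_div_eq_div_val, Units.val_mul, Units.val_pow_eq_pow_val]
  field_simp

theorem prod_odd {ι : Type*} [Fintype ι] (p υ : ℂˣ) (β : ι → ℂˣ) :
    ∏ i, odd p (υ * β i) =
      ((υ ^ Fintype.card ι * ∏ i, β i : ℂˣ) : ℂ)⁻¹ * ∏ i, theta p (υ ^ 2 * β i ^ 2) := by
  simp [odd, Finset.prod_mul_distrib, mul_pow]

theorem prod_theta_mem_quasiPeriodic (hp : ‖(p : ℂ)‖ < 1) {s : ℕ} (b : Fin s → ℂˣ) :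
    (fun u => ∏ i, theta p (u * b i)) ∈
      quasiPeriodic p ((-1) ^ s * ((∏ i, b i : ℂˣ) : ℂ)⁻¹) s := by
  refine ⟨differentiableOn_extend_prod _ fun i _ => differentiableOn_extend_theta hp (b i),
    fun u => ?_⟩
  simp only [mul_assoc p u, theta_p_mul hp, Finset.prod_mul_distrib, Finset.prod_neg,
    Units.val_mul, mul_inv, Finset.prod_const, Finset.card_univ, Fintype.card_fin, Finset.prod_inv_distrib,
    Units.coe_prod, zpow_neg, zpow_natCast, inv_pow]
  ring

theorem prod_update_mul {ι : Type*} [Fintype ι] [DecidableEq ι] (γ : ι → ℂˣ) (k : ι) (a : ℂˣ) :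
    ∏ i, Function.update γ k (a * γ k) i = a * ∏ i, γ i := by
  rw [Finset.prod_update_of_mem (Finset.mem_univ k), mul_assoc,
    ← Finset.prod_eq_mul_prod_sdiff_singleton_of_mem (Finset.mem_univ k) γ]

theorem prod_odd_update {s : ℕ} (p υ : ℂˣ) (γ : Fin s → ℂˣ) (k : Fin s) (a : ℂˣ) :
    ∏ i, odd p (υ * Function.update γ k a i) =
      odd p (υ * a) * ∏ i ∈ Finset.univ.erase k, odd p (υ * γ i) := by
  rw [← Finset.mul_prod_erase _ _ (Finset.mem_univ k), Function.update_self]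
  congr 1
  exact Finset.prod_congr rfl fun i hi => by
    rw [Function.update_of_ne (Finset.ne_of_mem_erase hi)]

/-- The coefficients of the partial fraction expansion of a product of odd theta functions. -/
noncomputable def pfCoeff (p : ℂˣ) {s : ℕ} (α γ : Fin s → ℂˣ) (k : Fin s) : ℂ :=
  (∏ j, odd p (γ k / (α j * γ j))) / ∏ i ∈ Finset.univ.erase k, odd p (γ k / γ i)

theorem partialFraction_at_node (hp : ‖(p : ℂ)‖ < 1) {s : ℕ} (α γ : Fin s → ℂˣ)
    (hγ : ∀ k i, k ≠ i → odd p (γ k / γ i) ≠ 0) (Θ : ℂˣ) (k : Fin s) :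
    pfCoeff p α γ k * ∏ i, odd p ((γ k)⁻¹ * Function.update γ k (Θ * γ k) i) =
      odd p Θ⁻¹ * ∏ i, odd p ((γ k)⁻¹ * (α i * γ i)) := by
  have h1 : ∏ i ∈ Finset.univ.erase k, odd p ((γ k)⁻¹ * γ i) =
      (-1) ^ (s - 1) * ∏ i ∈ Finset.univ.erase k, odd p (γ k / γ i) := by
    rw [show s - 1 = (Finset.univ.erase k).card by simp, ← Finset.prod_neg]
    refine Finset.prod_congr rfl fun i _ => ?_
    rw [← odd_inv hp, inv_div, div_eq_mul_inv, mul_comm]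
  have h2 : ∏ i, odd p ((γ k)⁻¹ * (α i * γ i)) =
      (-1) ^ s * ∏ i, odd p (γ k / (α i * γ i)) := by
    conv_rhs => enter [1, 2]; rw [show s = (Finset.univ : Finset (Fin s)).card by simp]
    rw [← Finset.prod_neg]
    refine Finset.prod_congr rfl fun i _ => ?_
    rw [← odd_inv hp, inv_div, div_eq_mul_inv _ (γ k), mul_comm]
  have h3 : ∏ i ∈ Finset.univ.erase k, odd p (γ k / γ i) ≠ 0 :=
    Finset.prod_ne_zero_iff.2 fun i hi => hγ k i (Finset.ne_of_mem_erase hi).symm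
  have h4 : (-1 : ℂ) ^ s = -(-1) ^ (s - 1) := by
    conv_lhs => rw [← Nat.sub_add_cancel k.pos, pow_succ]
    ring
  rw [prod_odd_update, h1, h2, h4, odd_inv hp, pfCoeff, mul_comm Θ, inv_mul_cancel_left]
  field_simp

/-- Up to a common factor, both sides are degree-`s` theta functions of `u = υ²` with the same
multiplier, which depends only on the product of the parameters. The `k`-th summand vanishes at the
nodes `u = γₗ⁻²`, `l ≠ k`, so comparing values at the `s` nodes suffices. The hypothesis on `∏ αᵢ`
makes it nonzero at its own node. -/
theorem partialFraction_of_ne_zero (hp : ‖(p : ℂ)‖ < 1) {s : ℕ} (hs : 1 ≤ s) (α γ : Fin s → ℂˣ)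
    (hγ : ∀ k i, k ≠ i → odd p (γ k / γ i) ≠ 0) (hα : odd p (∏ i, α i) ≠ 0) (υ : ℂˣ) :
    ∑ k, pfCoeff p α γ k * ∏ i, odd p (υ * Function.update γ k ((∏ i, α i) * γ k) i) =
      odd p (∏ i, α i)⁻¹ * ∏ i, odd p (υ * (α i * γ i)) := by
  set Θ := ∏ i, α i with hΘ
  let β : Fin s → Fin s → ℂˣ := fun k => Function.update γ k (Θ * γ k)
  have hβ : ∀ k, ∏ i, β k i = Θ * ∏ i, γ i := fun k => prod_update_mul γ k Θ
  have hαγ : ∏ i, α i * γ i = Θ * ∏ i, γ i := Finset.prod_mul_distrib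
  let κ : ℂ := (-1) ^ s * (((Θ * ∏ i, γ i) ^ 2 : ℂˣ) : ℂ)⁻¹
  have hκ : κ ≠ 0 := mul_ne_zero (pow_ne_zero _ (by norm_num)) (inv_ne_zero (Units.ne_zero _))
  have hmem : ∀ b : Fin s → ℂˣ, ∏ i, b i = Θ * ∏ i, γ i →
      (fun u => ∏ i, theta p (u * b i ^ 2)) ∈ quasiPeriodic p κ s := fun b hb => by
    have h := prod_theta_mem_quasiPeriodic hp fun i => b i ^ 2
    rwa [Finset.prod_pow, hb] at h
  let φ : Fin s → quasiPeriodic p κ s := fun k => ⟨_, hmem (β k) (hβ k)⟩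
  let g : quasiPeriodic p κ s := ⟨_, hmem (fun i => α i * γ i) hαγ⟩
  have hodd : ∀ (b : Fin s → ℂˣ) (υ : ℂˣ), ∏ i, b i = Θ * ∏ i, γ i → ∏ i, odd p (υ * b i) =
      ((υ ^ s * (Θ * ∏ i, γ i) : ℂˣ) : ℂ)⁻¹ * ∏ i, theta p (υ ^ 2 * b i ^ 2) := fun b υ hb => by
    rw [prod_odd, hb, Fintype.card_fin]
  have hnode : ∀ k υ, (φ k : ℂˣ → ℂ) (υ ^ 2) = ((υ ^ s * (Θ * ∏ i, γ i) : ℂˣ) : ℂ) *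
      ∏ i, odd p (υ * β k i) := fun k υ => by
    rw [hodd _ _ (hβ k), mul_inv_cancel_left₀ (Units.ne_zero _)]
  have hnode' : ∀ υ, (g : ℂˣ → ℂ) (υ ^ 2) = ((υ ^ s * (Θ * ∏ i, γ i) : ℂˣ) : ℂ) *
      ∏ i, odd p (υ * (α i * γ i)) := fun υ => by
    rw [hodd (fun i => α i * γ i) _ hαγ, mul_inv_cancel_left₀ (Units.ne_zero _)]
  have hzero : ∀ k l, k ≠ l → (φ k : ℂˣ → ℂ) ((γ l)⁻¹ ^ 2) = 0 := fun k l hkl => by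
    rw [hnode, Finset.prod_eq_zero (Finset.mem_univ l), mul_zero]
    simp [β, hkl.symm, odd_one]
  have hmain := quasiPeriodic_eq_zero_of_dual_family hκ hs (fun k => (γ k)⁻¹ ^ 2) φ hzero
    (fun k => ?_) (f := ∑ k, pfCoeff p α γ k • φ k - odd p Θ⁻¹ • g) fun l => ?_
  · have h := congrFun (congrArg Subtype.val hmain) (υ ^ 2)
    simp only [AddSubgroupClass.coe_sub, Submodule.coe_sum, Submodule.coe_smul, Pi.sub_apply,
      Finset.sum_apply, Pi.smul_apply, smul_eq_mul, ZeroMemClass.coe_zero, Pi.zero_apply,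
      sub_eq_zero, hnode, hnode', mul_left_comm _ ((υ ^ s * (Θ * ∏ i, γ i) : ℂˣ) : ℂ)] at h
    rw [← Finset.mul_sum] at h
    exact mul_left_cancel₀ (Units.ne_zero _) h
  · rw [hnode]
    refine mul_ne_zero (Units.ne_zero _) ?_
    change ∏ i, odd p ((γ k)⁻¹ * Function.update γ k (Θ * γ k) i) ≠ 0
    rw [prod_odd_update, mul_comm Θ, inv_mul_cancel_left]
    refine mul_ne_zero hα (Finset.prod_ne_zero_iff.2 fun i hi => ?_)
    rw [mul_comm, ← div_eq_mul_inv]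
    exact hγ i k (Finset.ne_of_mem_erase hi)
  · simp only [AddSubgroupClass.coe_sub, Submodule.coe_sum, Submodule.coe_smul, Pi.sub_apply,
      Finset.sum_apply, Pi.smul_apply, smul_eq_mul]
    rw [Finset.sum_eq_single l (fun k _ hk => by rw [hzero k l hk, mul_zero]) (by simp), hnode,
      hnode', mul_left_comm, mul_left_comm (odd p Θ⁻¹), ← mul_sub, partialFraction_at_node hp α γ hγ,
      sub_self, mul_zero]

/-- Partial fraction expansion of a product of odd theta functions. -/
theorem partialFraction (hp : ‖(p : ℂ)‖ < 1) {s : ℕ} (hs : 1 ≤ s) (α γ : Fin s → ℂˣ)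
    (hγ : ∀ k i, k ≠ i → odd p (γ k / γ i) ≠ 0) (υ : ℂˣ) :
    ∑ k, pfCoeff p α γ k * (odd p (υ * ((∏ i, α i) * γ k)) *
        ∏ i ∈ Finset.univ.erase k, odd p (υ * γ i)) =
      odd p (∏ i, α i)⁻¹ * ∏ i, odd p (υ * (α i * γ i)) := by
  let i₀ : Fin s := ⟨0, hs⟩
  have hodd := continuous_odd hp
  have hα : Continuous fun ξ : ℂˣ => Function.update α i₀ ξ := continuous_const.update i₀ continuous_id
  have hL : Continuous fun α : Fin s → ℂˣ => ∑ k, pfCoeff p α γ k *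
      (odd p (υ * ((∏ i, α i) * γ k)) * ∏ i ∈ Finset.univ.erase k, odd p (υ * γ i)) := by
    unfold pfCoeff
    fun_prop
  have hR : Continuous fun α : Fin s → ℂˣ =>
      odd p (∏ i, α i)⁻¹ * ∏ i, odd p (υ * (α i * γ i)) := by
    fun_prop
  -- Varying the single parameter `α i₀` reaches a nonzero `[(∏ αᵢ)²]` on a dense set; `α` does not
  -- enter the denominators, so both sides are continuous in it.
  have h := eq_of_forall_theta_ne_zero hp (fun _ : Unit => (∏ i ∈ Finset.univ \ {i₀}, α i) ^ 2)
    (hL.comp hα) (hR.comp hα) fun ξ hξ => ?_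
  · simpa using congrFun h (α i₀)
  · have h := partialFraction_of_ne_zero hp hs (Function.update α i₀ ξ) γ hγ ?_ υ
    · simp only [prod_odd_update] at h
      exact h
    · rw [odd_ne_zero, Finset.prod_update_of_mem (Finset.mem_univ i₀), mul_pow, mul_comm]
      exact hξ ()

theorem oddFactorial_succ_left (p τ ξ : ℂˣ) (k : ℕ) :
    oddFactorial p τ ξ (k + 1) = odd p ξ * oddFactorial p τ (τ * ξ) k := by
  simp [oddFactorial, Finset.prod_range_succ', pow_succ, mul_assoc, mul_comm, mul_left_comm]

theorem oddFactorial_succ_right (p τ ξ : ℂˣ) (k : ℕ) :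
    oddFactorial p τ ξ (k + 1) = oddFactorial p τ ξ k * odd p (τ ^ k * ξ) := by
  simp [oddFactorial, Finset.prod_range_succ]

theorem continuous_oddFactorial (hp : ‖(p : ℂ)‖ < 1) (τ : ℂˣ) (k : ℕ) :
    Continuous fun ξ => oddFactorial p τ ξ k := by
  have := continuous_odd hp
  unfold oddFactorial
  fun_prop

end Odd

/-! ### The evaluation formula -/

/-- The numerator products in the evaluation formula. -/
noncomputable def evalNum (p τ : ℂˣ) {s : ℕ} (n : ℕ) (μ : Fin s → ℕ) (γ : Fin s → ℂˣ) (υ : ℂˣ) :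
    ℂ :=
  ∏ i, (oddFactorial p τ (υ / γ i) (n - μ i) * oddFactorial p τ (τ ^ μ i * υ * γ i) (n - μ i))

/-- The denominator in the evaluation formula. -/
noncomputable def evalDen (p τ : ℂˣ) {s : ℕ} (μ : Fin s → ℕ) (γ : Fin s → ℂˣ) : ℂ :=
  (∏ i, ∏ j, oddFactorial p τ (τ ^ (-(μ j : ℤ)) * γ i / γ j) (μ i)) *
    ∏ i, ∏ j ∈ Finset.Ioi i, oddFactorial p τ (γ i * γ j) (μ i + μ j)

section Evaluation

variable {p t τ : ℂˣ} {s n : ℕ}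

theorem prod_prod_Ioi_ite (k : Fin s) (g : Fin s → ℂ) :
    ∏ i, ∏ j ∈ Finset.Ioi i, (if i = k then g j else if j = k then g i else 1) =
      ∏ j ∈ Finset.univ.erase k, g j := by
  have h : ∀ i ∈ Finset.univ.erase k,
      ∏ j ∈ Finset.Ioi i, (if i = k then g j else if j = k then g i else 1) =
        if i < k then g i else 1 := fun i hi => by
    simp [Finset.ne_of_mem_erase hi, Finset.prod_ite_eq']
  rw [← Finset.mul_prod_erase _ _ (Finset.mem_univ k), Finset.prod_congr rfl h]
  simp only [if_true]
  have h' : ∏ j ∈ Finset.Ioi k, g j = ∏ j ∈ Finset.univ.erase k, if j < k then 1 else g j := by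
    rw [Finset.prod_ite, Finset.prod_const_one, one_mul]
    refine Finset.prod_congr (Finset.ext fun j => ?_) fun _ _ => rfl
    simp only [Finset.mem_Ioi, Finset.mem_filter, Finset.mem_erase, Finset.mem_univ, and_true,
      not_lt]
    exact ⟨fun h => ⟨h.ne', h.le⟩, fun h => lt_of_le_of_ne h.2 h.1.symm⟩
  rw [h', ← Finset.prod_mul_distrib]
  refine Finset.prod_congr rfl fun j _ => ?_
  split_ifs <;> simp

/-- Passing from `(μ + εₖ, γ)` to `(μ, shift τ γ k)` leaves each endpoint `τ^{μⱼ} γⱼ` fixed, so only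
the factorials with `i = k`, or from pairs containing `k`, change: each loses its first factor. -/
theorem evalDen_add_single (p τ : ℂˣ) (μ : Fin s → ℕ) (γ : Fin s → ℂˣ) (k : Fin s) :
    evalDen p τ (μ + Pi.single k 1) γ = evalDen p τ μ (shift τ γ k) *
      (∏ j, odd p (γ k / (τ ^ (μ + Pi.single k 1 : Fin s → ℕ) j * γ j))) *
        ∏ j ∈ Finset.univ.erase k, odd p (γ k * γ j) := by
  set M := μ + Pi.single k 1 with hM
  have hMk : M k = μ k + 1 := by simp [hM]
  have hMne : ∀ j, j ≠ k → M j = μ j := fun j hj => by simp [hM, hj]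
  have hγk : shift τ γ k k = τ * γ k := by simp [shift]
  have hγne : ∀ j, j ≠ k → shift τ γ k j = γ j := fun j hj => by simp [shift, hj]
  have h1 : ∀ i j, oddFactorial p τ (τ ^ (-(M j : ℤ)) * γ i / γ j) (M i) =
      (if i = k then odd p (γ k / (τ ^ M j * γ j)) else 1) *
        oddFactorial p τ (τ ^ (-(μ j : ℤ)) * shift τ γ k i / shift τ γ k j) (μ i) := by
    intro i j
    have hexp : ∀ x y : ℂˣ, ∀ m : ℕ, τ ^ (-(m : ℤ)) * x / y = x / (τ ^ m * y) := fun x y m => by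
      rw [zpow_neg, zpow_natCast, div_mul_eq_div_div, div_eq_mul_inv x, mul_comm]
    rw [hexp, hexp]
    have hj : τ ^ μ j * shift τ γ k j = τ ^ M j * γ j := by
      rcases eq_or_ne j k with rfl | hj
      · rw [hγk, hMk, pow_succ, mul_assoc]
      · rw [hγne j hj, hMne j hj]
    rw [hj]
    rcases eq_or_ne i k with rfl | hi
    · rw [if_pos rfl, hMk, hγk, oddFactorial_succ_left, mul_div_assoc]
    · rw [if_neg hi, hMne i hi, hγne i hi, one_mul]
  have h2 : ∀ i, ∀ j ∈ Finset.Ioi i, oddFactorial p τ (γ i * γ j) (M i + M j) =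
      (if i = k then odd p (γ k * γ j) else if j = k then odd p (γ k * γ i) else 1) *
        oddFactorial p τ (shift τ γ k i * shift τ γ k j) (μ i + μ j) := by
    intro i j hij
    have hij := (Finset.mem_Ioi.1 hij).ne
    rcases eq_or_ne i k with rfl | hi
    · rw [if_pos rfl, hMk, hMne j hij.symm, hγk, hγne j hij.symm, add_right_comm,
        oddFactorial_succ_left, mul_assoc]
    · rw [if_neg hi]
      rcases eq_or_ne j k with rfl | hj
      · rw [if_pos rfl, hMk, hMne i hi, hγk, hγne i hi, ← add_assoc, oddFactorial_succ_left,
          mul_comm (γ i), mul_comm (γ i), mul_assoc]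
      · rw [if_neg hj, hMne i hi, hMne j hj, hγne i hi, hγne j hj, one_mul]
  rw [evalDen, evalDen, Finset.prod_congr rfl fun i _ => Finset.prod_congr rfl fun j _ => h1 i j,
    Finset.prod_congr rfl fun i _ => Finset.prod_congr rfl (h2 i)]
  simp only [Finset.prod_mul_distrib]
  rw [prod_prod_Ioi_ite k fun j => odd p (γ k * γ j)]
  have h3 : ∏ i, ∏ j, (if i = k then odd p (γ k / (τ ^ M j * γ j)) else 1) =
      ∏ j, odd p (γ k / (τ ^ M j * γ j)) := by
    rw [Finset.prod_eq_single k (fun i _ hi => by simp [hi]) (by simp)]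
    simp
  rw [h3]
  ring

/-- For `i ≠ k` both factorials gain a first factor. For `i = k` the first is unchanged, while the
second keeps its length and slides by one step, trading a factor at the far end for one at the near
end. -/
theorem evalNum_add_single (p τ : ℂˣ) (μ : Fin s → ℕ) (hμ : ∀ i, μ i ≤ n) (γ : Fin s → ℂˣ)
    (k : Fin s) (υ : ℂˣ) :
    (∏ i, odd p (υ * (τ ^ (μ + Pi.single k 1 : Fin s → ℕ) i * γ i))) *
        evalNum p τ n μ (shift τ γ k) (τ * υ) *
        ∏ i ∈ Finset.univ.erase k, odd p (υ / γ i) =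
      evalNum p τ (n + 1) (μ + Pi.single k 1) γ υ * odd p (υ * (τ ^ (n + 1) * γ k)) := by
  set M := μ + Pi.single k 1 with hM
  have hMk : M k = μ k + 1 := by simp [hM]
  have hMne : ∀ j, j ≠ k → M j = μ j := fun j hj => by simp [hM, hj]
  rw [evalNum, evalNum, ← Finset.mul_prod_erase _ _ (Finset.mem_univ k),
    ← Finset.mul_prod_erase _ (fun i => oddFactorial p τ (τ * υ / shift τ γ k i) (n - μ i) *
      oddFactorial p τ (τ ^ μ i * (τ * υ) * shift τ γ k i) (n - μ i)) (Finset.mem_univ k),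
    ← Finset.mul_prod_erase _ (fun i => oddFactorial p τ (υ / γ i) (n + 1 - M i) *
      oddFactorial p τ (τ ^ M i * υ * γ i) (n + 1 - M i)) (Finset.mem_univ k)]
  have hne : ∀ i ∈ Finset.univ.erase k, oddFactorial p τ (υ / γ i) (n + 1 - M i) *
      oddFactorial p τ (τ ^ M i * υ * γ i) (n + 1 - M i) = odd p (υ * (τ ^ M i * γ i)) *
      (oddFactorial p τ (τ * υ / shift τ γ k i) (n - μ i) *
        oddFactorial p τ (τ ^ μ i * (τ * υ) * shift τ γ k i) (n - μ i)) * odd p (υ / γ i) := by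
    intro i hi
    have hi := Finset.ne_of_mem_erase hi
    have hγi : shift τ γ k i = γ i := by simp [shift, hi]
    rw [hMne i hi, hγi, Nat.succ_sub (hμ i), Nat.succ_eq_add_one, oddFactorial_succ_left,
      oddFactorial_succ_left, mul_div_assoc, mul_left_comm υ, mul_left_comm _ τ υ, mul_assoc τ,
      mul_assoc (τ ^ μ i)]
    ring
  have hk : odd p (υ * (τ ^ M k * γ k)) *
      (oddFactorial p τ (τ * υ / shift τ γ k k) (n - μ k) *
        oddFactorial p τ (τ ^ μ k * (τ * υ) * shift τ γ k k) (n - μ k)) =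
      oddFactorial p τ (υ / γ k) (n + 1 - M k) *
      oddFactorial p τ (τ ^ M k * υ * γ k) (n + 1 - M k) * odd p (υ * (τ ^ (n + 1) * γ k)) := by
    have hγk : shift τ γ k k = τ * γ k := by simp [shift]
    have h1 : τ ^ μ k * (τ * υ) * (τ * γ k) = τ * (τ ^ M k * υ * γ k) := by
      rw [hMk, pow_succ]; simp only [mul_assoc, mul_left_comm, mul_comm]
    have h2 : υ * (τ ^ (n + 1) * γ k) = τ ^ (n - μ k) * (τ ^ M k * υ * γ k) := by
      rw [hMk, show n + 1 = (n - μ k) + (μ k + 1) by have := hμ k; omega, pow_add]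
      simp only [mul_left_comm, mul_comm]
    have h3 : υ * (τ ^ M k * γ k) = τ ^ M k * υ * γ k := by
      simp only [mul_left_comm, mul_comm]
    rw [hγk, mul_div_mul_left_eq_div, h1, h2, h3, show n + 1 - M k = n - μ k by omega,
      mul_left_comm, ← oddFactorial_succ_left, oddFactorial_succ_right, ← mul_assoc (oddFactorial _ _ _ _)]
  rw [Finset.prod_congr rfl hne]
  simp only [Finset.prod_mul_distrib]
  linear_combination (∏ i ∈ Finset.univ.erase k, odd p (υ * (τ ^ M i * γ i))) *
    (∏ i ∈ Finset.univ.erase k, oddFactorial p τ (τ * υ / shift τ γ k i) (n - μ i)) *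
    (∏ i ∈ Finset.univ.erase k,
      oddFactorial p τ (τ ^ μ i * (τ * υ) * shift τ γ k i) (n - μ i)) *
    (∏ i ∈ Finset.univ.erase k, odd p (υ / γ i)) * hk

theorem geomPoint_succ (t u : ℂˣ) (n : ℕ) :
    geomPoint t u (n + 1) = Fin.cons u (geomPoint t (t * u) n) := by
  funext j
  refine Fin.cases ?_ (fun j => ?_) j
  · simp [geomPoint]
  · simp [geomPoint, pow_succ, mul_assoc]

theorem continuous_comp_geomPoint {f : (Fin n → ℂˣ) → ℂ} (hf : Holomorphic f) (t : ℂˣ) :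
    Continuous fun υ : ℂˣ => f (geomPoint t (υ ^ 2) n) := by
  obtain ⟨F, hF, hFf⟩ := hf
  simp only [← hFf]
  refine hF.continuousOn.comp_continuous (continuous_pi fun i => ?_) fun υ i => Units.ne_zero _
  exact Units.continuous_val.comp (continuous_const.mul (continuous_pow 2))

theorem continuous_evalNum (hp : ‖(p : ℂ)‖ < 1) (τ : ℂˣ) (n : ℕ) (μ : Fin s → ℕ)
    (γ : Fin s → ℂˣ) : Continuous (evalNum p τ n μ γ) := by
  refine continuous_finsetProd _ fun i _ => ?_
  have h := continuous_oddFactorial hp τ (n - μ i)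
  refine (h.comp (f := fun υ : ℂˣ => υ / γ i) ?_).mul
    (h.comp (f := fun υ : ℂˣ => τ ^ μ i * υ * γ i) ?_)
  · fun_prop
  · fun_prop

theorem Generic.odd_ne_zero {γ : Fin s → ℂˣ} {c : Fin s → ℂˣ} (hγ : ∀ i, γ i ^ 2 = c i)
    (hc : Generic p t c n) (hn : 0 < n) {k l : Fin s} (hkl : k ≠ l) :
    odd p (γ k * γ l) ≠ 0 ∧ odd p (γ k / γ l) ≠ 0 := by
  have h := hc.ne_zero hn k l hkl
  rw [← hγ, ← hγ, e_sq] at h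
  exact mul_ne_zero_iff.1 h

theorem lagrange_eq_odd {γ : Fin s → ℂˣ} {c : Fin s → ℂˣ} (hγ : ∀ i, γ i ^ 2 = c i) (k : Fin s)
    (υ : ℂˣ) : lagrange p c k (υ ^ 2) =
      (∏ i ∈ Finset.univ.erase k, odd p (υ * γ i)) *
        (∏ i ∈ Finset.univ.erase k, odd p (υ / γ i)) /
      ((∏ i ∈ Finset.univ.erase k, odd p (γ k * γ i)) *
        ∏ i ∈ Finset.univ.erase k, odd p (γ k / γ i)) := by
  simp only [lagrange, ← hγ, e_sq, Finset.prod_div_distrib, Finset.prod_mul_distrib]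

theorem addUnit_injective (k : Fin s) :
    Function.Injective fun μ : Z s n => addUnit μ k := fun _ _ h =>
  Subtype.ext (add_right_cancel (congrArg Subtype.val h))

theorem exists_eq_addUnit {μ : Z s (n + 1)} {k : Fin s} (hk : μ.1 k ≠ 0) :
    ∃ ν : Z s n, μ = addUnit ν k := by
  have h : μ.1 - Pi.single k 1 + Pi.single k 1 = μ.1 := tsub_add_cancel_of_le <| by
    intro i
    rcases eq_or_ne i k with rfl | hi
    · simpa using Nat.one_le_iff_ne_zero.2 hk
    · simp [hi]
  refine ⟨⟨μ.1 - Pi.single k 1, ?_⟩, Subtype.ext h.symm⟩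
  have h' := μ.2
  rw [← h] at h'
  simpa [Finset.sum_add_distrib] using h'

theorem Z.le (μ : Z s n) (i : Fin s) : μ.1 i ≤ n :=
  (Finset.single_le_sum (fun _ _ => Nat.zero_le _) (Finset.mem_univ i)).trans_eq μ.2

/-- The evaluation formula at `(u, tu, …, t^{n-1}u)`, multiplied by its denominator. -/
theorem apply_geomPoint_mul_evalDen (hp : ‖(p : ℂ)‖ < 1) (hs : 1 ≤ s) (hτ : τ ^ 2 = t)
    {c γ : Fin s → ℂˣ} (hγ : ∀ i, γ i ^ 2 = c i) (hc : Generic p t c n) {μ : Z s n}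
    {f : (Fin n → ℂˣ) → ℂ} (hf : f ∈ thetaSpace p s n)
    (hμ : ∀ ν : Z s n, f (refPoint t c ν) = if μ = ν then 1 else 0) (υ : ℂˣ) :
    f (geomPoint t (υ ^ 2) n) * evalDen p τ μ.1 γ =
      oddFactorial p τ (τ ^ (-(n : ℤ))) n * evalNum p τ n μ.1 γ υ := by
  induction n generalizing c γ υ with
  | zero =>
    have h0 : μ.1 = 0 := funext fun i => Nat.le_zero.1 (Z.le μ i)
    have h1 := hμ μ
    rw [if_pos rfl] at h1
    rw [show f (geomPoint t (υ ^ 2) 0) = 1 from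
      (congrArg f (Subsingleton.elim _ _)).trans h1, h0]
    simp [evalDen, evalNum, oddFactorial]
  | succ n ih =>
    -- `Q` clears the first factors by which the numerators for `μ` and for `μ - εₖ` differ, making
    -- `evalNum` common to all terms.
    let Q : ℂˣ → ℂ := fun υ => ∏ i, odd p (υ * (τ ^ μ.1 i * γ i))
    have hγs : ∀ k i, shift τ γ k i ^ 2 = shift t c k i := fun k i => by
      rcases eq_or_ne i k with rfl | hi
      · simp [shift, mul_pow, hτ, hγ]
      · simp [shift, hi, hγ]
    have hterm : ∀ υ k, Q υ * (lagrange p c k (υ ^ 2) *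
        f (Fin.cons (c k) (geomPoint t (t * υ ^ 2) n)) * evalDen p τ μ.1 γ) =
        oddFactorial p τ (τ ^ (-(n : ℤ))) n * evalNum p τ (n + 1) μ.1 γ υ *
          (pfCoeff p (fun i => τ ^ μ.1 i) γ k * (odd p (υ * (τ ^ (n + 1) * γ k)) *
            ∏ i ∈ Finset.univ.erase k, odd p (υ * γ i))) := by
      intro υ k
      by_cases hk : μ.1 k = 0
      -- No `ν + εₖ` equals `μ` when `μₖ = 0`, so the restriction vanishes; on the other side the
      -- factor `j = k` of `pfCoeff` is `[1] = 0`.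
      · have h1 : (fun z => f (Fin.cons (c k) z)) = 0 := by
          refine eq_zero_of_refPoint hp hs (hc.shift k) (cons_right_mem hf (c k)) fun ν => ?_
          rw [apply_refPoint_addUnit hf, hμ, if_neg]
          rintro rfl
          simp [addUnit] at hk
        have h2 : pfCoeff p (fun i => τ ^ μ.1 i) γ k = 0 := by
          rw [pfCoeff, Finset.prod_eq_zero (Finset.mem_univ k), zero_div]
          simp [hk, odd_one]
        rw [show f (Fin.cons (c k) (geomPoint t (t * υ ^ 2) n)) = 0 from congrFun h1 _, h2]
        ring
      · obtain ⟨ν, rfl⟩ := exists_eq_addUnit hk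
        have h1 := ih (hγs k) (hc.shift k) (cons_right_mem hf (c k)) (μ := ν)
          (fun ν' => by
            rw [apply_refPoint_addUnit hf, hμ]
            simp only [(addUnit_injective k).eq_iff]) (τ * υ)
        rw [mul_pow, hτ] at h1
        have h2 := evalDen_add_single p τ ν.1 γ k
        have h3 := evalNum_add_single p τ ν.1 (Z.le ν) γ k υ
        have h4 : ∏ i ∈ Finset.univ.erase k, odd p (γ k * γ i) ≠ 0 :=
          Finset.prod_ne_zero_iff.2 fun i hi =>
            (hc.odd_ne_zero hγ n.succ_pos (Finset.ne_of_mem_erase hi).symm).1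
        have h5 : ∏ i ∈ Finset.univ.erase k, odd p (γ k / γ i) ≠ 0 :=
          Finset.prod_ne_zero_iff.2 fun i hi =>
            (hc.odd_ne_zero hγ n.succ_pos (Finset.ne_of_mem_erase hi).symm).2
        change (∏ i, odd p (υ * (τ ^ (ν.1 + Pi.single k 1 : Fin s → ℕ) i * γ i))) *
          (_ * _ * evalDen p τ (ν.1 + Pi.single k 1) γ) =
          _ * evalNum p τ (n + 1) (ν.1 + Pi.single k 1) γ υ *
            ((∏ j, odd p (γ k / (τ ^ (ν.1 + Pi.single k 1 : Fin s → ℕ) j * γ j))) / _ * _)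
        rw [h2, lagrange_eq_odd hγ]
        field_simp
        linear_combination
          (∏ i, odd p (υ * (τ ^ (ν.1 + Pi.single k 1 : Fin s → ℕ) i * γ i))) *
            (∏ i ∈ Finset.univ.erase k, odd p (υ * γ i)) *
            (∏ i ∈ Finset.univ.erase k, odd p (υ / γ i)) *
            (∏ j, odd p (γ k / (τ ^ (ν.1 + Pi.single k 1 : Fin s → ℕ) j * γ j))) * h1 +
          oddFactorial p τ (τ ^ (-(n : ℤ))) n *
            (∏ i ∈ Finset.univ.erase k, odd p (υ * γ i)) *
            (∏ j, odd p (γ k / (τ ^ (ν.1 + Pi.single k 1 : Fin s → ℕ) j * γ j))) * h3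
    have hprod : ∏ i, τ ^ μ.1 i = τ ^ (n + 1) := by
      rw [Finset.prod_pow_eq_pow_sum, μ.2]
    have hQ : ∀ υ, Q υ * (f (geomPoint t (υ ^ 2) (n + 1)) * evalDen p τ μ.1 γ) =
        Q υ * (oddFactorial p τ (τ ^ (-((n + 1 : ℕ) : ℤ))) (n + 1) *
          evalNum p τ (n + 1) μ.1 γ υ) := by
      intro υ
      have hpf := partialFraction hp hs (fun i => τ ^ μ.1 i) γ
        (fun k i hki => (hc.odd_ne_zero hγ n.succ_pos hki).2) υ
      rw [hprod] at hpf
      rw [geomPoint_succ, apply_cons_eq_sum_lagrange hp hs hc hf, Finset.sum_mul, Finset.mul_sum,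
        Finset.sum_congr rfl fun k _ => hterm υ k, ← Finset.mul_sum, hpf, oddFactorial_succ_left]
      -- The first factor `[t^{-(n+1)}]` of the new factorial is the constant produced by the
      -- partial fraction expansion.
      have h1 : τ * τ ^ (-((n + 1 : ℕ) : ℤ)) = τ ^ (-(n : ℤ)) := by
        rw [← zpow_one_add]
        congr 1
        push_cast
        ring
      rw [h1, zpow_neg τ ((n + 1 : ℕ) : ℤ), zpow_natCast]
      ring
    -- `Q` is nonzero on a dense set of `υ`, so it cancels by continuity.
    have h := eq_of_forall_theta_ne_zero hp (fun i => (τ ^ μ.1 i * γ i) ^ 2)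
      ((continuous_comp_geomPoint hf.1 t).mul_const (evalDen p τ μ.1 γ))
      ((continuous_evalNum hp τ (n + 1) μ.1 γ).const_mul
        (oddFactorial p τ (τ ^ (-((n + 1 : ℕ) : ℤ))) (n + 1))) fun υ hυ => ?_
    · exact congrFun h υ
    · refine mul_left_cancel₀ (Finset.prod_ne_zero_iff.2 fun i _ => ?_) (hQ υ)
      rw [EllipticBC.odd_ne_zero, mul_pow, mul_comm]
      exact hυ i

theorem theta_mul_ne_zero_of_e_ne_zero {u v : ℂˣ} (h : e p u v ≠ 0) :
    theta p (u * v) ≠ 0 ∧ theta p (u / v) ≠ 0 := by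
  rw [e] at h
  exact ⟨right_ne_zero_of_mul (left_ne_zero_of_mul h), right_ne_zero_of_mul h⟩

/-- Diagonal factors are `θ(t^{-k})`, `1 ≤ k ≤ μᵢ`, up to units. For `i ≠ j`, cancelling common
powers of `t` leaves factors of some `e(tᵃcᵢ, tᵇcⱼ)` with `a + b < n`, because `μᵢ + μⱼ ≤ n`. -/
theorem evalDen_ne_zero (hp : ‖(p : ℂ)‖ < 1) (hτ : τ ^ 2 = t) {c γ : Fin s → ℂˣ}
    (hγ : ∀ i, γ i ^ 2 = c i) (hc : Generic p t c n) (μ : Z s n)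
    (hμ : ∀ (i : Fin s) (k : ℕ), 1 ≤ k → k ≤ μ.1 i → theta p (t ^ k) ≠ 0) :
    evalDen p τ μ.1 γ ≠ 0 := by
  have hpair : ∀ i j, i ≠ j → μ.1 i + μ.1 j ≤ n := fun i j hij => by
    rw [← Finset.sum_pair hij]
    exact (Finset.sum_le_sum_of_subset (Finset.subset_univ _)).trans_eq μ.2
  refine mul_ne_zero (Finset.prod_ne_zero_iff.2 fun i _ => Finset.prod_ne_zero_iff.2 fun j _ =>
    Finset.prod_ne_zero_iff.2 fun l hl => ?_) (Finset.prod_ne_zero_iff.2 fun i _ =>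
    Finset.prod_ne_zero_iff.2 fun j hij => Finset.prod_ne_zero_iff.2 fun l hl => ?_)
  · have hl := Finset.mem_range.1 hl
    rw [odd_ne_zero]
    have hsq : (τ ^ l * (τ ^ (-(μ.1 j : ℤ)) * γ i / γ j)) ^ 2 =
        t ^ l * c i / (t ^ μ.1 j * c j) := by
      rw [← hτ, ← hγ, ← hγ, zpow_neg, zpow_natCast, Units.ext_iff]
      simp only [Units.val_div_eq_div_val, Units.val_mul, Units.val_pow_eq_pow_val,
        Units.val_inv_eq_inv_val]
      field_simp
      ring
    rw [hsq]
    rcases eq_or_ne i j with rfl | hij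
    · have h1 : t ^ l * c i / (t ^ μ.1 i * c i) = (t ^ (μ.1 i - l))⁻¹ := by
        rw [mul_div_mul_right_eq_div, ← inv_div, pow_sub _ hl.le, div_eq_mul_inv]
      rw [h1, theta_inv hp]
      exact mul_ne_zero (neg_ne_zero.2 (inv_ne_zero (Units.ne_zero _)))
        (hμ i _ (by omega) (by omega))
    · have hle := hpair i j hij
      rcases le_total (μ.1 j) l with h | h
      · obtain ⟨d, rfl⟩ := Nat.exists_eq_add_of_le h
        have h1 := hc i j hij d 0 (by omega)
        convert (theta_mul_ne_zero_of_e_ne_zero h1).2 using 2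
        rw [pow_add, mul_assoc, mul_div_mul_left_eq_div, pow_zero, one_mul]
      · obtain ⟨d, hd⟩ := Nat.exists_eq_add_of_le h
        have h1 := hc i j hij 0 d (by omega)
        convert (theta_mul_ne_zero_of_e_ne_zero h1).2 using 2
        rw [hd, pow_add, mul_assoc, mul_div_mul_left_eq_div, pow_zero, one_mul]
  · have hl := Finset.mem_range.1 hl
    have hij := (Finset.mem_Ioi.1 hij).ne
    have hle := hpair i j hij
    rw [odd_ne_zero]
    have h1 := hc i j hij l 0 (by omega)
    convert (theta_mul_ne_zero_of_e_ne_zero h1).1 using 2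
    rw [← hτ, ← hγ, ← hγ, pow_zero, one_mul, mul_pow, mul_pow, ← pow_mul, ← pow_mul, mul_comm l,
      mul_assoc]

end Evaluation

end EllipticBC

theorem theorem2p1 (p t : ℂˣ) (hp : ‖(p : ℂ)‖ < 1) (ht : ‖(t : ℂ)‖ < 1)
    (s n : ℕ) (hs : 1 ≤ s) (c : Fin s → ℂˣ)
    (hc : ∀ k l : Fin s, k ≠ l → ∀ i j : ℕ, i + j < n →
      EllipticBC.e p (t ^ i * c k) (t ^ j * c l) ≠ 0) :
    (∃! E : Module.Basis (EllipticBC.Z s n) ℂ (EllipticBC.thetaSpace p s n),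
      EllipticBC.IsInterpolationBasis p t c E) ∧
    ∀ E : Module.Basis (EllipticBC.Z s n) ℂ (EllipticBC.thetaSpace p s n),
      EllipticBC.IsInterpolationBasis p t c E →
      ∀ μ : EllipticBC.Z s n,
        (∀ (i : Fin s) (k : ℕ), 1 ≤ k → k ≤ μ.1 i → EllipticBC.theta p (t ^ k) ≠ 0) →
        ∀ (u τ υ : ℂˣ) (γ : Fin s → ℂˣ), τ ^ 2 = t → υ ^ 2 = u → (∀ i, γ i ^ 2 = c i) →
          (E μ : (Fin n → ℂˣ) → ℂ) (EllipticBC.geomPoint t u n) =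
            (EllipticBC.oddFactorial p τ (τ ^ (-(n : ℤ))) n *
              ∏ i, (EllipticBC.oddFactorial p τ (υ / γ i) (n - μ.1 i) *
                EllipticBC.oddFactorial p τ (τ ^ μ.1 i * υ * γ i) (n - μ.1 i))) /
            ((∏ i, ∏ j,
                EllipticBC.oddFactorial p τ (τ ^ (-(μ.1 j : ℤ)) * γ i / γ j) (μ.1 i)) *
              ∏ i, ∏ j ∈ Finset.Ioi i,
                EllipticBC.oddFactorial p τ (γ i * γ j) (μ.1 i + μ.1 j)) := by
  refine ⟨EllipticBC.existsUnique_interpolationBasis hp hs hc, ?_⟩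
  rintro E hE μ hμ u τ υ γ hτ rfl hγ
  exact (eq_div_iff (EllipticBC.evalDen_ne_zero hp hτ hγ hc μ hμ)).2
    (EllipticBC.apply_geomPoint_mul_evalDen hp hs hτ hγ hc (E μ).2 (hE μ) υ)
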